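/- Let $N\ge 2$, $1<p<\infty$, $b^-<b^+$, $a>0$, and let $\Omega=\{x=(x',x_N)\in\mathbb{R}^{N-1}\times\mathbb{R} : b^-<x_N<b^+\}$ with $\Gamma^\pm=\{x_N=b^\pm\}$. Let $\dot W^{1,p}(\Omega)$ be the space of $u\in L^1_{\mathrm{loc}}(\Omega)$ whose weak gradient $\nabla u$ belongs to $L^p(\Omega)$. For $f\in L^1_{\mathrm{loc}}(\mathbb{R}^{N-1})$ define the screened seminorm $$|f|_{\widetilde W^{1-1/p,p}_{(a)}}=\left(\int_{\mathbb{R}^{N-1}}\int_{\{|h'|<a\}}\frac{|f(x'+h')-f(x')|^p}{|h'|^{p+N-2}}\,dh'\,dx'\right)^{1/p}.$$ Let $X$ be the linear space of pairs $(f^-,f^+)$ of functions in $L^1_{\mathrm{loc}}(\mathbb{R}^{N-1})$ (modulo equality almost everywhere) with $f^+-f^-\in L^p(\mathbb{R}^{N-1})$, $|f^-|_{\widetilde W^{1-1/p,p}_{(a)}}<\infty$ and $|f^+|_{\widetilde W^{1-1/p,p}_{(a)}}<\infty$. Then there is a linear map $X\to\dot W^{1,p}(\Omega)$, $(f^-,f^+)\mapsto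 u$, such that for all $(f^-,f^+)\in X$ one has $\operatorname{Tr}u=f^-$ on $\Gamma^-$, $\operatorname{Tr}u=f^+$ on $\Gamma^+$, and $$\int_\Omega|\nabla u|^p\,dx\le c\,(b^+-b^-)^{1-p}\int_{\mathbb{R}^{N-1}}|f^+-f^-|^p\,dx'+c\,|f^-|^p_{\widetilde W^{1-1/p,p}_{(a)}}+c\,|f^+|^p_{\widetilde W^{1-1/p,p}_{(a)}},$$ where the constant $c>0$ depends only on $N$, $p$ and a positive lower bound for the ratio $a/(b^+-b^-)$. Here $\operatorname{Tr}u=f^\pm$ on $\Gamma^\pm$ means that $f^\pm\in L^p_{\mathrm{loc}}(\mathbb{R}^{N-1})$, that $u$ is integrable on $\Omega\cap K$ for every compact $K\subset\mathbb{R}^N$, and that for all $\psi\in C^1_c(\mathbb{R}^N)$ and $i=1,\dots,N$ $$\int_\Omega u\,\partial_i\psi\,dx=-\int_\Omega\psi\,\partial_iu\,dx+\int_{\mathbb{R}^{N-1}}\psi(x',b^+)f^+(x')\,\nu^+_i\,dx'+\int_{\mathbb{R}^{N-1}}\psi(x',b^-)f^-(x')\,\nu^-_i\,dx',$$ with outer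 unit normals $\nu^\pm=\pm e_N$; this determines $f^\pm$ almost everywhere. -/

import Mathlib

open MeasureTheory Set
open scoped ENNReal ContDiff

noncomputable section

/-- The horizontal space `ℝⁿ`, with its Euclidean norm and Lebesgue measure; `n = N - 1`. -/
abbrev Horiz (n : ℕ) : Type := EuclideanSpace ℝ (Fin n)

/-- The full space `ℝᴺ = ℝⁿ × ℝ`, `N = n + 1`, with points `x = (x', x_N)` and Lebesgue measure.
Only the topology, the linear structure and the measure of the product are used; lengths of
gradients are measured in `Grad n`, which carries the Euclidean norm. -/
abbrev Full (n : ℕ) : Type := Horiz n × ℝ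

/-- The space `ℝᴺ` of gradients, with the Euclidean inner product and norm
`|(w', w_N)|² = |w'|² + w_N²`. -/
abbrev Grad (n : ℕ) : Type := WithLp 2 (Horiz n × ℝ)

/-- The flat strip `Ω = {x : b⁻ < x_N < b⁺}`. -/
def strip (n : ℕ) (bm bp : ℝ) : Set (Full n) := {x | bm < x.2 ∧ x.2 < bp}

/-- `G` is the weak (distributional) gradient of `u` on `U`: for all `φ ∈ C_c^∞(U)` and all
directions `v`, `∫_U u ∂_v φ = - ∫_U φ (G · v)`. -/
def IsWeakGradient {n : ℕ} (U : Set (Full n)) (u : Full n → ℝ) (G : Full n → Grad n) : Prop :=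
  ∀ φ : Full n → ℝ, ContDiff ℝ ∞ φ → HasCompactSupport φ → tsupport φ ⊆ U →
    ∀ v : Full n,
      ∫ x in U, u x * fderiv ℝ φ x v = -∫ x in U, φ x * inner ℝ (G x) (WithLp.toLp 2 v)

/-- Membership in `Ẇ^{1,p}(U)`: `u ∈ L¹_loc(U)` and the weak gradient of `u` exists and is in
`L^p(U)`. -/
def MemHomSobolev {n : ℕ} (U : Set (Full n)) (p : ℝ) (u : Full n → ℝ) : Prop :=
  (∀ K : Set (Full n), IsCompact K → K ⊆ U → IntegrableOn u K) ∧
    ∃ G : Full n → Grad n,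
      IsWeakGradient U u G ∧ MemLp G (ENNReal.ofReal p) (volume.restrict U)

section Closure

variable {n : ℕ} {U : Set (Full n)} {p : ℝ} {u w : Full n → ℝ}

theorem integrable_mul_test {φ : Full n → ℝ} {K : Set (Full n)} (hK : IsCompact K)
    (hu : IntegrableOn u K) (hφ : Continuous φ) (hφK : ∀ x, x ∉ K → φ x = 0) :
    Integrable (fun x => u x * φ x) (volume.restrict U) := by
  have h1 : IntegrableOn (fun x => u x * φ x) K := hu.mul_continuousOn hφ.continuousOn hK
  have h2 : Integrable (fun x => u x * φ x) volume := by
    rw [← integrableOn_iff_integrable_of_support_subset (s := K)]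
    · exact h1
    · intro x hx
      by_contra hxK
      exact hx (by simp [hφK x hxK])
  exact h2.mono_measure Measure.restrict_le_self

theorem integrable_mul_fderiv (hu : ∀ K : Set (Full n), IsCompact K → K ⊆ U → IntegrableOn u K)
    {φ : Full n → ℝ} (h1 : ContDiff ℝ ∞ φ) (h2 : HasCompactSupport φ) (h3 : tsupport φ ⊆ U)
    (v : Full n) :
    Integrable (fun x => u x * fderiv ℝ φ x v) (volume.restrict U) := by
  refine integrable_mul_test (K := tsupport φ) h2 (hu _ h2 h3) ?_ ?_
  · exact (h1.continuous_fderiv (by simp)).clm_apply continuous_const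
  · intro x hx
    have : fderiv ℝ φ x = 0 := by
      by_contra h
      exact hx (support_fderiv_subset ℝ h)
    simp [this]

theorem integrable_mul_inner (hp : 1 < p) {G : Full n → Grad n}
    (hG : MemLp G (ENNReal.ofReal p) (volume.restrict U))
    {φ : Full n → ℝ} (h1 : Continuous φ) (h2 : HasCompactSupport φ) (h3 : tsupport φ ⊆ U)
    (v : Full n) :
    Integrable (fun x => φ x * inner ℝ (G x) (WithLp.toLp 2 v)) (volume.restrict U) := by
  have hloc : IntegrableOn G (tsupport φ) := by
    have h4 : MemLp G (ENNReal.ofReal p) (volume.restrict (tsupport φ)) :=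
      hG.mono_measure (Measure.restrict_mono h3 le_rfl)
    have : IsFiniteMeasure (volume.restrict (tsupport φ)) :=
      ⟨by simpa using h2.isCompact.measure_lt_top⟩
    exact memLp_one_iff_integrable.1 (h4.mono_exponent (by simpa using hp.le))
  have h5 : IntegrableOn (fun x => inner ℝ (G x) (WithLp.toLp 2 v)) (tsupport φ) :=
    hloc.inner_const _
  have h6 := integrable_mul_test (U := U) h2.isCompact h5 h1
    (fun x hx => image_eq_zero_of_notMem_tsupport hx)
  simpa only [mul_comm] using h6

theorem MemHomSobolev.congr (h : u =ᵐ[volume.restrict U] w) (hu : MemHomSobolev U p u) :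
    MemHomSobolev U p w := by
  obtain ⟨h1, G, h2, h3⟩ := hu
  refine ⟨fun K hK hKU => (h1 K hK hKU).congr (ae_restrict_of_ae_restrict_of_subset hKU h),
    G, fun φ a b c v => ?_, h3⟩
  rw [← h2 φ a b c v]
  refine integral_congr_ae ?_
  filter_upwards [h] with x hx
  rw [hx]

theorem MemHomSobolev.zero : MemHomSobolev U p (fun _ : Full n => (0 : ℝ)) := by
  refine ⟨fun K _ _ => integrableOn_zero, fun _ => 0, fun φ _ _ _ v => ?_, MemLp.zero'⟩
  simp

theorem MemHomSobolev.add (hp : 1 < p) (hu : MemHomSobolev U p u) (hw : MemHomSobolev U p w) :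
    MemHomSobolev U p (fun x => u x + w x) := by
  obtain ⟨h1, G, h2, h3⟩ := hu
  obtain ⟨k1, H, k2, k3⟩ := hw
  refine ⟨fun K hK hKU => (h1 K hK hKU).add (k1 K hK hKU), fun x => G x + H x,
    fun φ a b c v => ?_, h3.add k3⟩
  simp only [add_mul, inner_add_left, mul_add]
  rw [integral_add (integrable_mul_fderiv h1 a b c v) (integrable_mul_fderiv k1 a b c v),
    integral_add (integrable_mul_inner hp h3 a.continuous b c v)
      (integrable_mul_inner hp k3 a.continuous b c v), h2 φ a b c v, k2 φ a b c v]
  ring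

theorem MemHomSobolev.smul (r : ℝ) (hu : MemHomSobolev U p u) :
    MemHomSobolev U p (fun x => r * u x) := by
  obtain ⟨h1, G, h2, h3⟩ := hu
  refine ⟨fun K hK hKU => (h1 K hK hKU).const_mul r, fun x => r • G x,
    fun φ a b c v => ?_, h3.const_smul r⟩
  simp only [inner_smul_left, mul_assoc, RCLike.conj_to_real, mul_left_comm _ r]
  rw [integral_const_mul, integral_const_mul, h2 φ a b c v, mul_neg]

end Closure

/-- The homogeneous Sobolev space `Ẇ^{1,p}(U)`, as a linear space of functions on `U` modulo
equality almost everywhere. -/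
def HomSobolev {n : ℕ} (U : Set (Full n)) (p : ℝ) (hp : 1 < p) :
    Submodule ℝ (Full n →ₘ[volume.restrict U] ℝ) where
  carrier := {u | MemHomSobolev U p u}
  zero_mem' := MemHomSobolev.zero.congr AEEqFun.coeFn_zero.symm
  add_mem' {u w} hu hw := (MemHomSobolev.add hp hu hw).congr (AEEqFun.coeFn_add u w).symm
  smul_mem' r u hu := (MemHomSobolev.smul r hu).congr (AEEqFun.coeFn_smul r u).symm

/-- The weak gradient `∇u` of `u ∈ Ẇ^{1,p}(U)`. -/
def weakGrad {n : ℕ} {U : Set (Full n)} {p : ℝ} {hp : 1 < p} (u : HomSobolev U p hp) :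
    Full n → Grad n :=
  u.2.2.choose

theorem weakGrad_spec {n : ℕ} {U : Set (Full n)} {p : ℝ} {hp : 1 < p} (u : HomSobolev U p hp) :
    IsWeakGradient U u.1 (weakGrad u) ∧
      MemLp (weakGrad u) (ENNReal.ofReal p) (volume.restrict U) :=
  u.2.2.choose_spec

/-- `Tr u = f⁻` on `Γ⁻ = {x_N = b⁻}` and `Tr u = f⁺` on `Γ⁺ = {x_N = b⁺}`: the functions `f^±` are
in `L^p_loc(ℝⁿ)` and, for every `ψ ∈ C_c^1(ℝᴺ)` (whose support may meet `∂Ω`) and every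
direction `v`, `∫_Ω u ∂_v ψ = - ∫_Ω ψ ∂_v u + ∫_{∂Ω} ψ (Tr u) (ν · v)`, where the outer unit normal
`ν` is `e_N` on `Γ⁺` and `-e_N` on `Γ⁻`. This formula determines `f^±` almost everywhere. The
middle clause says that `u` is integrable up to the boundary on bounded sets, so that all the
integrals in the formula are genuine. -/
def HasTrace {n : ℕ} {bm bp p : ℝ} {hp : 1 < p} (u : HomSobolev (strip n bm bp) p hp)
    (fm fp : Horiz n → ℝ) : Prop :=
  (∀ K : Set (Horiz n), IsCompact K →
    MemLp fm (ENNReal.ofReal p) (volume.restrict K) ∧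
      MemLp fp (ENNReal.ofReal p) (volume.restrict K)) ∧
  (∀ K : Set (Full n), IsCompact K → IntegrableOn (u.1 : Full n → ℝ) (K ∩ strip n bm bp)) ∧
  ∀ ψ : Full n → ℝ, ContDiff ℝ 1 ψ → HasCompactSupport ψ → ∀ v : Full n,
    ∫ x in strip n bm bp, u.1 x * fderiv ℝ ψ x v =
      -(∫ x in strip n bm bp, ψ x * inner ℝ (weakGrad u x) (WithLp.toLp 2 v))
        + ((∫ x', ψ (x', bp) * fp x' * v.2) + ∫ x', ψ (x', bm) * fm x' * (-v.2))

/-- The screened seminorm `|f|_{W̃^{1-1/p,p}_{(a)}(ℝⁿ)}`, i.e. (with `N = n + 1`) the `p`-th root of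
`∫_{ℝⁿ} ∫_{|h'| < a} |f(x'+h') - f(x')|^p / |h'|^{p+N-2} dh' dx'`. -/
def screenedSeminorm {n : ℕ} (a p : ℝ) (f : Horiz n → ℝ) : ℝ≥0∞ :=
  (∫⁻ x, ∫⁻ h in Metric.ball (0 : Horiz n) a,
    ‖f (x + h) - f x‖ₑ ^ p / ‖h‖ₑ ^ (p + (n : ℝ) - 1)) ^ (1 / p)

section ScreenedClosure

variable {n : ℕ} {a p : ℝ} {f g : Horiz n → ℝ}

theorem screenedSeminorm_congr (h : f =ᵐ[volume] g) :
    screenedSeminorm a p f = screenedSeminorm a p g := by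
  unfold screenedSeminorm
  congr 1
  refine lintegral_congr_ae ?_
  filter_upwards [h] with x hx
  refine lintegral_congr_ae (ae_restrict_of_ae ?_)
  have := (measurePreserving_add_left (volume : Measure (Horiz n)) x).quasiMeasurePreserving.ae h
  filter_upwards [this] with y hy
  rw [hx, hy]

theorem screenedSeminorm_zero (hp : 1 < p) :
    screenedSeminorm a p (fun _ : Horiz n => (0 : ℝ)) = 0 := by
  have hp0 : 0 < p := by linarith
  simp [screenedSeminorm, ENNReal.zero_rpow_of_pos hp0, hp0]

theorem screenedSeminorm_lt_top_iff (hp : 1 < p) : screenedSeminorm a p f < ⊤ ↔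
    ∫⁻ x, ∫⁻ h in Metric.ball (0 : Horiz n) a,
      ‖f (x + h) - f x‖ₑ ^ p / ‖h‖ₑ ^ (p + (n : ℝ) - 1) < ⊤ := by
  have hp0 : 0 < 1 / p := by positivity
  unfold screenedSeminorm
  rw [ENNReal.rpow_lt_top_iff_of_pos hp0]

theorem lintegral_lintegral_lt_top_of_le {F G H : Horiz n → Horiz n → ℝ≥0∞} {C : ℝ≥0∞}
    {S : Set (Horiz n)} (hC : C ≠ ⊤) (hF : Measurable (Function.uncurry F))
    (h : ∀ x y, H x y ≤ C * (F x y + G x y))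
    (h1 : ∫⁻ x, ∫⁻ y in S, F x y < ⊤) (h2 : ∫⁻ x, ∫⁻ y in S, G x y < ⊤) :
    ∫⁻ x, ∫⁻ y in S, H x y < ⊤ := by
  have hF1 : ∀ x, Measurable (F x) := fun x => hF.of_uncurry_left
  have hF2 : Measurable fun x => ∫⁻ y in S, F x y := hF.lintegral_prod_right'
  calc ∫⁻ x, ∫⁻ y in S, H x y ≤ ∫⁻ x, ∫⁻ y in S, C * (F x y + G x y) :=
        lintegral_mono fun x => lintegral_mono fun y => h x y
    _ = ∫⁻ x, C * ((∫⁻ y in S, F x y) + ∫⁻ y in S, G x y) := by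
        refine lintegral_congr fun x => ?_
        rw [lintegral_const_mul' _ _ hC, lintegral_add_left (hF1 x)]
    _ = C * ((∫⁻ x, ∫⁻ y in S, F x y) + ∫⁻ x, ∫⁻ y in S, G x y) := by
        rw [lintegral_const_mul' _ _ hC, lintegral_add_left hF2]
    _ < ⊤ := ENNReal.mul_lt_top hC.lt_top (ENNReal.add_lt_top.2 ⟨h1, h2⟩)

theorem screenedSeminorm_add (hp : 1 < p) (hf : AEStronglyMeasurable f)
    (hf' : screenedSeminorm a p f < ⊤) (hg' : screenedSeminorm a p g < ⊤) :
    screenedSeminorm a p (fun x => f x + g x) < ⊤ := by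
  obtain ⟨k, hk, e⟩ : ∃ k : Horiz n → ℝ, Measurable k ∧ f =ᵐ[volume] k :=
    ⟨hf.mk f, hf.stronglyMeasurable_mk.measurable, hf.ae_eq_mk⟩
  have e2 : (fun x => f x + g x) =ᵐ[volume] fun x => k x + g x := by
    filter_upwards [e] with x hx
    rw [hx]
  rw [screenedSeminorm_congr e2]
  rw [screenedSeminorm_congr e] at hf'
  rw [screenedSeminorm_lt_top_iff hp] at hf' hg' ⊢
  have hC : (2 : ℝ≥0∞) ^ (p - 1) ≠ ⊤ := ENNReal.rpow_ne_top_of_nonneg (by linarith) (by simp)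
  refine lintegral_lintegral_lt_top_of_le hC ?_ (fun x h => ?_) hf' hg'
  · have h1 : Measurable fun z : Horiz n × Horiz n => k (z.1 + z.2) - k z.1 :=
      (hk.comp (measurable_fst.add measurable_snd)).sub (hk.comp measurable_fst)
    exact (h1.enorm.pow_const p).div (measurable_snd.enorm.pow_const _)
  · rw [← ENNReal.add_div, ← mul_div_assoc]
    refine ENNReal.div_le_div_right
      (le_trans ?_ (ENNReal.rpow_add_le_mul_rpow_add_rpow _ _ hp.le)) _
    refine ENNReal.rpow_le_rpow ?_ (by linarith)
    rw [add_sub_add_comm]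
    exact enorm_add_le _ _

theorem screenedSeminorm_smul (hp : 1 < p) (r : ℝ) (hf' : screenedSeminorm a p f < ⊤) :
    screenedSeminorm a p (fun x => r * f x) < ⊤ := by
  have hp0 : 0 ≤ p := by linarith
  rw [screenedSeminorm_lt_top_iff hp] at hf' ⊢
  have hC : ‖r‖ₑ ^ p ≠ ⊤ := ENNReal.rpow_ne_top_of_nonneg hp0 (by simp)
  simp only [← mul_sub, enorm_mul, ENNReal.mul_rpow_of_nonneg _ _ hp0, mul_div_assoc]
  simp only [lintegral_const_mul' _ _ hC]
  exact ENNReal.mul_lt_top hC.lt_top hf'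

end ScreenedClosure

/-- Membership in the space of admissible boundary data: `f^± ∈ L¹_loc(ℝⁿ)`, `f⁺ - f⁻ ∈ L^p(ℝⁿ)`,
and both screened seminorms are finite. -/
structure MemTraceData {n : ℕ} (a p : ℝ) (fm fp : Horiz n → ℝ) : Prop where
  locInt_minus : LocallyIntegrable fm
  locInt_plus : LocallyIntegrable fp
  diff : MemLp (fun x => fp x - fm x) (ENNReal.ofReal p)
  screened_minus : screenedSeminorm a p fm < ⊤
  screened_plus : screenedSeminorm a p fp < ⊤

theorem locallyIntegrable_congr_ae {n : ℕ} {f g : Horiz n → ℝ} (h : f =ᵐ[volume] g)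
    (hf : LocallyIntegrable f) : LocallyIntegrable g := by
  rw [locallyIntegrable_iff] at hf ⊢
  exact fun K hK => (hf K hK).congr (ae_restrict_of_ae h)

theorem MemTraceData.congr {n : ℕ} {a p : ℝ} {fm fp gm gp : Horiz n → ℝ}
    (hm : fm =ᵐ[volume] gm) (hp : fp =ᵐ[volume] gp) (h : MemTraceData a p fm fp) :
    MemTraceData a p gm gp where
  locInt_minus := locallyIntegrable_congr_ae hm h.locInt_minus
  locInt_plus := locallyIntegrable_congr_ae hp h.locInt_plus
  diff := h.diff.ae_eq (by
    filter_upwards [hm, hp] with x h1 h2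
    rw [h1, h2])
  screened_minus := by
    rw [← screenedSeminorm_congr hm]
    exact h.screened_minus
  screened_plus := by
    rw [← screenedSeminorm_congr hp]
    exact h.screened_plus

/-- The linear space of admissible boundary data `(f⁻, f⁺)`, functions being taken modulo equality
almost everywhere. -/
def TraceData (n : ℕ) (a p : ℝ) (hp : 1 < p) :
    Submodule ℝ ((Horiz n →ₘ[volume] ℝ) × (Horiz n →ₘ[volume] ℝ)) where
  carrier := {f | MemTraceData a p f.1 f.2}
  zero_mem' := by
    have h : MemTraceData a p (fun _ : Horiz n => (0 : ℝ)) (fun _ : Horiz n => (0 : ℝ)) :=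
      { locInt_minus := locallyIntegrable_zero
        locInt_plus := locallyIntegrable_zero
        diff := by simp
        screened_minus := by
          rw [screenedSeminorm_zero hp]
          simp
        screened_plus := by
          rw [screenedSeminorm_zero hp]
          simp }
    exact h.congr AEEqFun.coeFn_zero.symm AEEqFun.coeFn_zero.symm
  add_mem' {f g} hf hg := by
    have h : MemTraceData a p (fun x => f.1 x + g.1 x) (fun x => f.2 x + g.2 x) :=
      { locInt_minus := hf.locInt_minus.add hg.locInt_minus
        locInt_plus := hf.locInt_plus.add hg.locInt_plus
        diff := by
          have := hf.diff.add hg.diff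
          refine this.ae_eq (Filter.Eventually.of_forall fun x => ?_)
          simp only [Pi.add_apply]
          ring
        screened_minus := screenedSeminorm_add hp f.1.aestronglyMeasurable
          hf.screened_minus hg.screened_minus
        screened_plus := screenedSeminorm_add hp f.2.aestronglyMeasurable
          hf.screened_plus hg.screened_plus }
    exact h.congr (AEEqFun.coeFn_add f.1 g.1).symm (AEEqFun.coeFn_add f.2 g.2).symm
  smul_mem' r f hf := by
    have h : MemTraceData a p (fun x => r * f.1 x) (fun x => r * f.2 x) :=
      { locInt_minus := hf.locInt_minus.smul r
        locInt_plus := hf.locInt_plus.smul r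
        diff := by
          have := hf.diff.const_mul r
          refine this.ae_eq (Filter.Eventually.of_forall fun x => ?_)
          simp only
          ring
        screened_minus := screenedSeminorm_smul hp r hf.screened_minus
        screened_plus := screenedSeminorm_smul hp r hf.screened_plus }
    exact h.congr (AEEqFun.coeFn_smul r f.1).symm (AEEqFun.coeFn_smul r f.2).symm

end

/-
Let `f_s` be the mollification of `f` at scale `s`, let `κ = min l 1` and let
`t = (x_N - b⁻) / (b⁺ - b⁻)`. The extension interpolates linearly between mollifications of the
boundary data at scales proportional to the distance to the face,
  `u(x', x_N) = (1 - t) f⁻_{κ(x_N - b⁻)}(x') + t f⁺_{κ(b⁺ - x_N)}(x')`.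
Both the full derivative of `(s, x') ↦ f_s(x')` and the rescaled defect `(f_s - f) / s` are bounded
by `s^{-N}` times the integral of `|f(y) - f(x')|` over `|y - x'| ≤ s`. By Jensen's inequality and
Fubini's theorem, integrating the `p`-th power of this bound over `x'` and over `0 < s < a` gives
the screened seminorm to the power `p`. What remains of `∇u` is `(f⁺ - f⁻) / (b⁺ - b⁻)`, up to such
defects; its `p`-th power integrates to the first term of the estimate. The condition `κ ≤ l` keeps
all scales below `a`. The traces come from integration by parts on vertical lines, since `f_s → f`
almost everywhere.
-/

noncomputable section

open Metric Filter Topology Module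
open scoped NNReal Convolution

section SmulCompSub

variable {E V : Type*} [NormedAddCommGroup E] [MeasurableSpace E] [BorelSpace E] {μ : Measure E}
  [NormedAddCommGroup V] [NormedSpace ℝ V] {f : E → ℝ} {K : E → V} {s : ℝ} {x : E}

theorem integrable_smul_comp_sub_left [ProperSpace E] (hf : LocallyIntegrable f μ)
    (hK : Continuous K) (hsupp : ∀ z, s < ‖z‖ → K z = 0) :
    Integrable (fun y => f y • K (x - y)) μ := by
  have hint : IntegrableOn (fun y => f y • K (x - y)) (closedBall x s) μ :=
    (hf.integrableOn_isCompact (isCompact_closedBall x s)).smul_continuousOn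
      (hK.comp (continuous_const.sub continuous_id)).continuousOn (isCompact_closedBall x s)
  refine (integrableOn_iff_integrable_of_support_subset fun y hy => ?_).1 hint
  contrapose! hy
  rw [mem_closedBall, not_le, dist_comm, dist_eq_norm] at hy
  simp [hsupp _ hy]

theorem enorm_integral_sub_smul_le {B : ℝ≥0∞} (hB : ∀ z, ‖K z‖ₑ ≤ B)
    (hsupp : ∀ z, s < ‖z‖ → K z = 0) :
    ‖∫ y, (f y - f x) • K (x - y) ∂μ‖ₑ ≤ ∫⁻ y in closedBall x s, B * ‖f y - f x‖ₑ ∂μ := by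
  refine (enorm_integral_le_lintegral_enorm _).trans ?_
  rw [← lintegral_indicator measurableSet_closedBall]
  refine lintegral_mono fun y => ?_
  by_cases hy : y ∈ closedBall x s
  · rw [indicator_of_mem hy, enorm_smul, mul_comm]
    gcongr
    exact hB _
  · rw [mem_closedBall, not_le, dist_comm, dist_eq_norm] at hy
    simp [hsupp _ hy]

end SmulCompSub

section Mollification

variable {E : Type*} [NormedAddCommGroup E] [NormedSpace ℝ E] [FiniteDimensional ℝ E]

/-- The smooth cut-off that equals `1` on the ball of radius `s / 2` and is supported in the ball
of radius `s`, before normalisation. -/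
def cutoffBump (E : Type*) [NormedAddCommGroup E] {s : ℝ} (hs : 0 < s) : ContDiffBump (0 : E) :=
  ⟨s / 2, s, half_pos hs, half_lt_self hs⟩

variable [MeasurableSpace E] (μ : Measure E) {f g : E → ℝ} {s : ℝ} {x : E}

/-- The standard mollifier `(s, z) ↦ s⁻ᵈ φ(z / s)`, `d = dim E`, as a function of the scale and of
the point jointly, so that its derivative also records the dependence on the scale. -/
def mollKernel (q : ℝ × E) : ℝ :=
  (q.1 ^ finrank ℝ E)⁻¹ * (cutoffBump E one_pos).normed μ (q.1⁻¹ • q.2)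

/-- The mollification `(s, x) ↦ (f * φ_s)(x)`, as a function of the scale and of the point. -/
def mollify (f : E → ℝ) (q : ℝ × E) : ℝ := ∫ y, f y * mollKernel μ (q.1, q.2 - y) ∂μ

/-- The derivative of the mollification together with the rescaled error of approximation; both
are dominated by the mean oscillation of `f` at scale `s`. -/
def mollDefect (f : E → ℝ) (s : ℝ) (x : E) : ℝ≥0∞ :=
  ‖fderiv ℝ (mollify μ f) (s, x)‖ₑ + ‖s⁻¹ * (mollify μ f (s, x) - f x)‖ₑ

theorem contDiffOn_mollKernel : ContDiffOn ℝ ∞ (mollKernel μ) (Ioi 0 ×ˢ univ) := by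
  have h0 : ∀ q ∈ Ioi (0 : ℝ) ×ˢ (univ : Set E), q.1 ≠ 0 := fun q hq => ne_of_gt hq.1
  exact ((contDiffOn_fst.pow _).inv fun q hq => pow_ne_zero _ (h0 q hq)).mul
    ((ContDiffBump.contDiff_normed _).comp_contDiffOn
      ((contDiffOn_fst.inv h0).smul contDiffOn_snd))

theorem continuous_mollKernel (hs : 0 < s) : Continuous fun z => mollKernel μ (s, z) :=
  (contDiffOn_mollKernel μ).continuousOn.comp_continuous (by fun_prop) fun _ => ⟨hs, trivial⟩

theorem continuous_fderiv_mollKernel (hs : 0 < s) :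
    Continuous fun z => fderiv ℝ (mollKernel μ) (s, z) :=
  ((contDiffOn_mollKernel μ).continuousOn_fderiv_of_isOpen (isOpen_Ioi.prod isOpen_univ)
    (by simp)).comp_continuous (by fun_prop) fun _ => ⟨hs, trivial⟩

theorem mollKernel_smul {c : ℝ} (hc : c ≠ 0) (q : ℝ × E) :
    mollKernel μ (c • q) = (c ^ finrank ℝ E)⁻¹ * mollKernel μ q := by
  have harg : (c * q.1)⁻¹ • c • q.2 = q.1⁻¹ • q.2 := by
    rw [smul_smul, mul_inv_rev, inv_mul_cancel_right₀ hc]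
  simp only [mollKernel, Prod.smul_fst, Prod.smul_snd, smul_eq_mul, harg]
  rw [mul_pow, mul_inv, mul_assoc]

theorem fderiv_mollKernel_smul {c : ℝ} (hc : c ≠ 0) (q : ℝ × E) :
    fderiv ℝ (mollKernel μ) (c • q) = (c ^ (finrank ℝ E + 1))⁻¹ • fderiv ℝ (mollKernel μ) q := by
  have hfun : (fun q => mollKernel μ (c • q)) = (c ^ finrank ℝ E)⁻¹ • mollKernel μ :=
    funext fun q => mollKernel_smul μ hc q
  have hderiv := fderiv_comp_smul (f := mollKernel μ) (x := q) c
  rw [hfun, fderiv_const_smul_field, Pi.smul_apply] at hderiv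
  rw [pow_succ', mul_inv, mul_smul, hderiv, inv_smul_smul₀ hc]

theorem mollify_congr_ae (h : f =ᵐ[μ] g) : mollify μ f = mollify μ g := by
  ext q
  refine integral_congr_ae ?_
  filter_upwards [h] with y hy
  rw [hy]

theorem mollify_smul (r : ℝ) : mollify μ (r • f) = r • mollify μ f := by
  ext q
  simp only [mollify, Pi.smul_apply, smul_eq_mul, mul_assoc, integral_const_mul]

variable [BorelSpace E] [μ.IsAddHaarMeasure]

theorem mollKernel_eq_normed (hs : 0 < s) (z : E) :
    mollKernel μ (s, z) = (cutoffBump E hs).normed μ z := by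
  have hcut (z : E) : cutoffBump E hs z = cutoffBump E one_pos (s⁻¹ • z) := by
    have hratio : s / (s / 2) = 1 / (1 / 2) := by field_simp
    have hinner : (s / 2)⁻¹ = (1 / 2)⁻¹ * s⁻¹ := by field_simp
    simp only [ContDiffBump.apply, cutoffBump, sub_zero, smul_smul, hratio, hinner]
  simp only [mollKernel, ContDiffBump.normed_def, hcut]
  rw [Measure.integral_comp_inv_smul, abs_of_pos (by positivity), smul_eq_mul]
  field_simp

theorem mollKernel_eq_zero (hs : 0 < s) {z : E} (hz : s ≤ ‖z‖) : mollKernel μ (s, z) = 0 := by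
  rw [mollKernel_eq_normed μ hs, ← Function.notMem_support, ContDiffBump.support_normed_eq,
    mem_ball_zero_iff, not_lt]
  exact hz

theorem integral_mollKernel (hs : 0 < s) : ∫ z, mollKernel μ (s, z) ∂μ = 1 := by
  simp only [mollKernel_eq_normed μ hs, ContDiffBump.integral_normed]

theorem fderiv_mollKernel_eq_zero (hs : 0 < s) {z : E} (hz : s < ‖z‖) :
    fderiv ℝ (mollKernel μ) (s, z) = 0 := by
  have hopen : IsOpen {q : ℝ × E | 0 < q.1 ∧ q.1 < ‖q.2‖} :=
    (isOpen_lt continuous_const continuous_fst).inter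
      (isOpen_lt continuous_fst continuous_snd.norm)
  have hzero : mollKernel μ =ᶠ[𝓝 (s, z)] fun _ => 0 := by
    filter_upwards [hopen.mem_nhds ⟨hs, hz⟩] with q hq
    exact mollKernel_eq_zero μ hq.1 hq.2.le
  rw [hzero.fderiv_eq, fderiv_fun_const, Pi.zero_apply]

theorem exists_enorm_mollKernel_le : ∃ C : ℝ≥0, ∀ s : ℝ, 0 < s → ∀ z : E,
    ‖mollKernel μ (s, z)‖ₑ ≤ C * ENNReal.ofReal (s ^ finrank ℝ E)⁻¹ := by
  obtain ⟨C, hC⟩ := (HasCompactSupport.intro (isCompact_closedBall (0 : E) 1) fun z hz =>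
    mollKernel_eq_zero μ one_pos (by simpa using hz : 1 < ‖z‖).le).exists_bound_of_continuous
      (continuous_mollKernel μ one_pos)
  refine ⟨C.toNNReal, fun s hs z => ?_⟩
  have hscale : (s, z) = s • ((1, s⁻¹ • z) : ℝ × E) := by
    simp [Prod.smul_mk, smul_inv_smul₀ hs.ne']
  rw [hscale, mollKernel_smul μ hs.ne', enorm_mul, mul_comm,
    Real.enorm_of_nonneg (r := (s ^ finrank ℝ E)⁻¹) (by positivity), ← ofReal_norm]
  gcongr
  exact ENNReal.ofReal_le_ofReal (hC _)

theorem exists_enorm_fderiv_mollKernel_le : ∃ C : ℝ≥0, ∀ s : ℝ, 0 < s → ∀ z : E,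
    ‖fderiv ℝ (mollKernel μ) (s, z)‖ₑ ≤ C * ENNReal.ofReal (s ^ (finrank ℝ E + 1))⁻¹ := by
  obtain ⟨C, hC⟩ := (HasCompactSupport.intro (isCompact_closedBall (0 : E) 1) fun z hz =>
    fderiv_mollKernel_eq_zero μ one_pos (by simpa using hz)).exists_bound_of_continuous
      (continuous_fderiv_mollKernel μ one_pos)
  refine ⟨C.toNNReal, fun s hs z => ?_⟩
  have hscale : (s, z) = s • ((1, s⁻¹ • z) : ℝ × E) := by
    simp [Prod.smul_mk, smul_inv_smul₀ hs.ne']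
  rw [hscale, fderiv_mollKernel_smul μ hs.ne', enorm_smul, mul_comm,
    Real.enorm_of_nonneg (by positivity), ← ofReal_norm]
  gcongr
  exact ENNReal.ofReal_le_ofReal (hC _)

theorem contDiffOn_mollify (hf : LocallyIntegrable f μ) :
    ContDiffOn ℝ ∞ (mollify μ f) (Ioi 0 ×ˢ univ) := by
  intro q hq
  have hmem : Ioo (0 : ℝ) (q.1 + 1) ×ˢ (univ : Set E) ∈ 𝓝 q :=
    (isOpen_Ioo.prod isOpen_univ).mem_nhds ⟨⟨hq.1, by linarith⟩, trivial⟩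
  have hsmooth := contDiffOn_convolution_right_with_param (n := ⊤)
    (g := fun s z => mollKernel μ (s, z)) (ContinuousLinearMap.mul ℝ ℝ)
    (isOpen_Ioo (a := (0 : ℝ)) (b := q.1 + 1)) (isCompact_closedBall (0 : E) (q.1 + 1))
    (fun s z hs hz => mollKernel_eq_zero μ hs.1 (hs.2.trans (by simpa using hz)).le) hf
    ((contDiffOn_mollKernel μ).mono (prod_mono Ioo_subset_Ioi_self le_rfl))
  exact (hsmooth.contDiffAt hmem).contDiffWithinAt

theorem continuous_mollify (hf : LocallyIntegrable f μ) (hs : 0 < s) :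
    Continuous fun x => mollify μ f (s, x) :=
  (contDiffOn_mollify μ hf).continuousOn.comp_continuous (by fun_prop) fun _ => ⟨hs, trivial⟩

theorem fderiv_mollify (hf : LocallyIntegrable f μ) (hs : 0 < s) :
    fderiv ℝ (mollify μ f) (s, x) = ∫ y, f y • fderiv ℝ (mollKernel μ) (s, x - y) ∂μ := by
  have hderiv := hasFDerivAt_convolution_right_with_param
    (g := fun s z => mollKernel μ (s, z)) (ContinuousLinearMap.mul ℝ ℝ)
    (isOpen_Ioo (a := (0 : ℝ)) (b := s + 1)) (isCompact_closedBall (0 : E) (s + 1))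
    (fun s z hs hz => mollKernel_eq_zero μ hs.1 (hs.2.trans (by simpa using hz)).le) hf
    (((contDiffOn_mollKernel μ).mono (prod_mono Ioo_subset_Ioi_self le_rfl)).of_le (by simp))
    (s, x) ⟨hs, by simp⟩
  exact hderiv.fderiv

theorem integrable_mul_mollKernel (hf : LocallyIntegrable f μ) (hs : 0 < s) :
    Integrable (fun y => f y * mollKernel μ (s, x - y)) μ :=
  integrable_smul_comp_sub_left hf (continuous_mollKernel μ hs)
    fun _ hz => mollKernel_eq_zero μ hs hz.le

theorem integrable_smul_fderiv_mollKernel (hf : LocallyIntegrable f μ) (hs : 0 < s) :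
    Integrable (fun y => f y • fderiv ℝ (mollKernel μ) (s, x - y)) μ :=
  integrable_smul_comp_sub_left (K := fun z => fderiv ℝ (mollKernel μ) (s, z)) hf
    (continuous_fderiv_mollKernel μ hs) fun _ hz => fderiv_mollKernel_eq_zero μ hs hz

theorem mollify_add (hf : LocallyIntegrable f μ) (hg : LocallyIntegrable g μ) (hs : 0 < s) :
    mollify μ (f + g) (s, x) = mollify μ f (s, x) + mollify μ g (s, x) := by
  simp only [mollify, Pi.add_apply, add_mul]
  exact integral_add (integrable_mul_mollKernel μ hf hs) (integrable_mul_mollKernel μ hg hs)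

theorem mollify_const (c : ℝ) (hs : 0 < s) : mollify μ (fun _ : E => c) (s, x) = c := by
  rw [mollify, integral_const_mul, integral_sub_left_eq_self (fun z => mollKernel μ (s, z)) μ x,
    integral_mollKernel μ hs, mul_one]

theorem mollify_sub_self (hf : LocallyIntegrable f μ) (hs : 0 < s) :
    mollify μ f (s, x) - f x = ∫ y, (f y - f x) • mollKernel μ (s, x - y) ∂μ := by
  conv_lhs => rw [← mollify_const μ (f x) hs (x := x)]
  simp only [smul_eq_mul, sub_mul]
  exact (integral_sub (integrable_mul_mollKernel μ hf hs)
    (integrable_mul_mollKernel μ (locallyIntegrable_const _) hs)).symm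

theorem integral_fderiv_mollKernel (hs : 0 < s) :
    ∫ y, fderiv ℝ (mollKernel μ) (s, x - y) ∂μ = 0 := by
  have hconst : mollify μ (fun _ : E => 1) =ᶠ[𝓝 (s, x)] fun _ => 1 := by
    have hmem : Ioi (0 : ℝ) ×ˢ (univ : Set E) ∈ 𝓝 (s, x) :=
      (isOpen_Ioi.prod isOpen_univ).mem_nhds ⟨hs, trivial⟩
    filter_upwards [hmem] with q hq
    exact mollify_const μ _ hq.1
  have hderiv := fderiv_mollify μ (f := fun _ => 1) (x := x) (locallyIntegrable_const _) hs
  rw [hconst.fderiv_eq, fderiv_fun_const, Pi.zero_apply] at hderiv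
  simpa only [one_smul] using hderiv.symm

theorem fderiv_mollify_eq_integral_sub (hf : LocallyIntegrable f μ) (hs : 0 < s) :
    fderiv ℝ (mollify μ f) (s, x) =
      ∫ y, (f y - f x) • fderiv ℝ (mollKernel μ) (s, x - y) ∂μ := by
  have hsplit := integral_sub (integrable_smul_fderiv_mollKernel μ (x := x) hf hs)
    (integrable_smul_fderiv_mollKernel μ (x := x) (locallyIntegrable_const (f x)) hs)
  rw [integral_smul, integral_fderiv_mollKernel μ hs, smul_zero, sub_zero] at hsplit
  rw [fderiv_mollify μ hf hs, ← hsplit]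
  exact integral_congr_ae (ae_of_all _ fun y => (sub_smul _ _ _).symm)

theorem exists_enorm_fderiv_mollify_le : ∃ C : ℝ≥0, ∀ f : E → ℝ, LocallyIntegrable f μ →
    ∀ s : ℝ, 0 < s → ∀ x, ‖fderiv ℝ (mollify μ f) (s, x)‖ₑ ≤
      C * ENNReal.ofReal (s ^ (finrank ℝ E + 1))⁻¹ * ∫⁻ y in closedBall x s, ‖f y - f x‖ₑ ∂μ := by
  obtain ⟨C, hC⟩ := exists_enorm_fderiv_mollKernel_le μ
  refine ⟨C, fun f hf s hs x => ?_⟩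
  rw [fderiv_mollify_eq_integral_sub μ hf hs, ← lintegral_const_mul' _ _ (by finiteness)]
  exact enorm_integral_sub_smul_le (K := fun z => fderiv ℝ (mollKernel μ) (s, z)) (hC s hs)
    fun z hz => fderiv_mollKernel_eq_zero μ hs hz

theorem exists_enorm_mollify_sub_self_le : ∃ C : ℝ≥0, ∀ f : E → ℝ, LocallyIntegrable f μ →
    ∀ s : ℝ, 0 < s → ∀ x, ‖mollify μ f (s, x) - f x‖ₑ ≤
      C * ENNReal.ofReal (s ^ finrank ℝ E)⁻¹ * ∫⁻ y in closedBall x s, ‖f y - f x‖ₑ ∂μ := by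
  obtain ⟨C, hC⟩ := exists_enorm_mollKernel_le μ
  refine ⟨C, fun f hf s hs x => ?_⟩
  rw [mollify_sub_self μ hf hs, ← lintegral_const_mul' _ _ (by finiteness)]
  exact enorm_integral_sub_smul_le (K := fun z => mollKernel μ (s, z)) (hC s hs)
    fun z hz => mollKernel_eq_zero μ hs hz.le

theorem exists_mollDefect_le : ∃ C : ℝ≥0, ∀ f : E → ℝ, LocallyIntegrable f μ →
    ∀ s : ℝ, 0 < s → ∀ x, mollDefect μ f s x ≤
      C * ENNReal.ofReal (s ^ (finrank ℝ E + 1))⁻¹ * ∫⁻ y in closedBall x s, ‖f y - f x‖ₑ ∂μ := by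
  obtain ⟨C₁, h₁⟩ := exists_enorm_fderiv_mollify_le μ
  obtain ⟨C₀, h₀⟩ := exists_enorm_mollify_sub_self_le μ
  refine ⟨C₁ + C₀, fun f hf s hs x => ?_⟩
  rw [ENNReal.coe_add, add_mul, add_mul]
  refine add_le_add (h₁ f hf s hs x) ?_
  calc ‖s⁻¹ * (mollify μ f (s, x) - f x)‖ₑ
      = ENNReal.ofReal s⁻¹ * ‖mollify μ f (s, x) - f x‖ₑ := by
        rw [enorm_mul, Real.enorm_of_nonneg (by positivity)]
    _ ≤ ENNReal.ofReal s⁻¹ * (C₀ * ENNReal.ofReal (s ^ finrank ℝ E)⁻¹ *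
          ∫⁻ y in closedBall x s, ‖f y - f x‖ₑ ∂μ) := by gcongr; exact h₀ f hf s hs x
    _ = _ := by
        rw [pow_succ', mul_inv, ENNReal.ofReal_mul (by positivity)]
        ring

theorem ae_tendsto_mollify (hf : LocallyIntegrable f μ) :
    ∀ᵐ x ∂μ, Tendsto (fun s => mollify μ f (s, x)) (𝓝[>] 0) (𝓝 (f x)) := by
  let φ (s : ℝ) : ContDiffBump (0 : E) :=
    if hs : 0 < s then cutoffBump E hs else cutoffBump E one_pos
  have hφ {s : ℝ} (hs : 0 < s) : φ s = cutoffBump E hs := dif_pos hs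
  have hsmall : Tendsto (fun s => (φ s).rOut) (𝓝[>] 0) (𝓝 0) := by
    refine (tendsto_nhdsWithin_of_tendsto_nhds tendsto_id).congr' ?_
    filter_upwards [self_mem_nhdsWithin] with s hs
    rw [hφ hs]
    rfl
  have hratio : ∀ᶠ s in 𝓝[>] 0, (φ s).rOut ≤ 2 * (φ s).rIn := by
    filter_upwards [self_mem_nhdsWithin] with s hs
    rw [hφ hs]
    exact (mul_div_cancel₀ s two_ne_zero).ge
  filter_upwards [ContDiffBump.ae_convolution_tendsto_right_of_locallyIntegrable hsmall hratio hf]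
    with x hx
  refine hx.congr' ?_
  filter_upwards [self_mem_nhdsWithin] with s hs
  rw [hφ hs, convolution_eq_swap, mollify]
  simp only [mollKernel_eq_normed μ hs, ContinuousLinearMap.lsmul_apply, smul_eq_mul, mul_comm]

end Mollification

section Oscillation

theorem rpow_lintegral_enorm_le {α G : Type*} [MeasurableSpace α] {μ : Measure α}
    [NormedAddCommGroup G] {f : α → G} {p : ℝ} (hp : 1 ≤ p) (hf : AEStronglyMeasurable f μ) :
    (∫⁻ y, ‖f y‖ₑ ∂μ) ^ p ≤ μ univ ^ (p - 1) * ∫⁻ y, ‖f y‖ₑ ^ p ∂μ := by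
  have hp0 : 0 < p := one_pos.trans_le hp
  have hnorm := eLpNorm'_le_eLpNorm'_mul_rpow_measure_univ one_pos hp hf
  simp only [eLpNorm', ENNReal.rpow_one, div_one] at hnorm
  calc (∫⁻ y, ‖f y‖ₑ ∂μ) ^ p
      ≤ ((∫⁻ y, ‖f y‖ₑ ^ p ∂μ) ^ (1 / p) * μ univ ^ (1 - 1 / p)) ^ p := by gcongr
    _ = μ univ ^ (p - 1) * ∫⁻ y, ‖f y‖ₑ ^ p ∂μ := by
      rw [ENNReal.mul_rpow_of_nonneg _ _ hp0.le, ← ENNReal.rpow_mul, ← ENNReal.rpow_mul,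
        one_div_mul_cancel hp0.ne', ENNReal.rpow_one, sub_mul, one_mul,
        one_div_mul_cancel hp0.ne', mul_comm]

theorem lintegral_Ioi_rpow_neg_le {q ρ : ℝ} (hq : 1 < q) (hρ : 0 ≤ ρ) :
    ∫⁻ s in Ioi ρ, ENNReal.ofReal (s ^ (-q)) ≤
      ENNReal.ofReal (q - 1)⁻¹ / ENNReal.ofReal ρ ^ (q - 1) := by
  have hq0 : 0 < q - 1 := sub_pos.2 hq
  rcases hρ.eq_or_lt with rfl | hρ
  · rw [ENNReal.ofReal_zero, ENNReal.zero_rpow_of_pos hq0,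
      ENNReal.div_zero (ENNReal.ofReal_pos.2 (inv_pos.2 hq0)).ne']
    exact le_top
  rw [← ofReal_integral_eq_lintegral_ofReal (integrableOn_Ioi_rpow_of_lt (by linarith) hρ),
    integral_Ioi_rpow_of_lt (by linarith) hρ, ENNReal.ofReal_rpow_of_pos hρ,
    ← ENNReal.ofReal_div_of_pos (Real.rpow_pos_of_pos hρ _)]
  · rw [show -q + 1 = -(q - 1) by ring, neg_div_neg_eq, Real.rpow_neg hρ.le, div_eq_mul_inv,
      div_eq_mul_inv, mul_comm]
  · filter_upwards [ae_restrict_mem measurableSet_Ioi] with s hs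
    exact Real.rpow_nonneg (hρ.trans hs).le _

variable {E : Type*} [NormedAddCommGroup E] [MeasurableSpace E] [BorelSpace E] (μ : Measure E)

theorem lintegral_Ioo_lintegral_closedBall_le [SecondCountableTopology E] [SFinite μ] {q a : ℝ}
    (hq : 1 < q) {D : E → ℝ≥0∞} (hD : Measurable D) :
    ∫⁻ s in Ioo 0 a, ENNReal.ofReal (s ^ (-q)) * ∫⁻ h in closedBall 0 s, D h ∂μ ≤
      ENNReal.ofReal (q - 1)⁻¹ * ∫⁻ h in ball 0 a, D h / ‖h‖ₑ ^ (q - 1) ∂μ := by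
  let W (s : ℝ) : ℝ≥0∞ := ENNReal.ofReal (s ^ (-q))
  let S : Set (ℝ × E) := {z | ‖z.2‖ ≤ z.1}
  let K (s : ℝ) (h : E) : ℝ≥0∞ := S.indicator (fun z => W z.1 * D z.2) (s, h)
  have hW : Measurable W := (measurable_id.pow_const _).ennreal_ofReal
  have hK : Measurable (Function.uncurry K) :=
    ((hW.comp measurable_fst).mul (hD.comp measurable_snd)).indicator
      (measurableSet_le measurable_snd.norm measurable_fst)
  have hslice (h : E) : ∫⁻ s in Ioo 0 a, K s h ≤
      ENNReal.ofReal (q - 1)⁻¹ * (D h / ‖h‖ₑ ^ (q - 1)) := by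
    calc ∫⁻ s in Ioo 0 a, K s h ≤ ∫⁻ s, (Ici ‖h‖).indicator (fun s => W s * D h) s :=
          setLIntegral_le_lintegral _ _
      _ = (∫⁻ s in Ioi ‖h‖, W s) * D h := by
          rw [lintegral_indicator measurableSet_Ici, ← Measure.restrict_congr_set Ioi_ae_eq_Ici,
            lintegral_mul_const _ hW]
      _ ≤ ENNReal.ofReal (q - 1)⁻¹ / ENNReal.ofReal ‖h‖ ^ (q - 1) * D h := by
          gcongr
          exact lintegral_Ioi_rpow_neg_le hq (norm_nonneg h)
      _ = _ := by rw [ofReal_norm, div_eq_mul_inv, div_eq_mul_inv, mul_assoc, mul_comm (D h)]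
  calc ∫⁻ s in Ioo 0 a, W s * ∫⁻ h in closedBall 0 s, D h ∂μ
      ≤ ∫⁻ s in Ioo 0 a, ∫⁻ h in ball 0 a, K s h ∂μ := by
        refine setLIntegral_mono' measurableSet_Ioo fun s hs => ?_
        rw [← lintegral_const_mul' _ _ ENNReal.ofReal_ne_top]
        refine (setLIntegral_mono_ae' measurableSet_closedBall (ae_of_all _ fun h hh => ?_)).trans
          (lintegral_mono_set (closedBall_subset_ball hs.2))
        have hmem : (s, h) ∈ S := mem_closedBall_zero_iff.1 hh
        exact (indicator_of_mem hmem fun z => W z.1 * D z.2).ge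
    _ = ∫⁻ h in ball 0 a, (∫⁻ s in Ioo 0 a, K s h) ∂μ := lintegral_lintegral_swap hK.aemeasurable
    _ ≤ _ := by
        rw [← lintegral_const_mul' _ _ ENNReal.ofReal_ne_top]
        exact lintegral_mono hslice

theorem lintegral_closedBall_eq_comp_add [μ.IsAddLeftInvariant] (F : E → ℝ≥0∞) (x : E) (s : ℝ) :
    ∫⁻ y in closedBall x s, F y ∂μ = ∫⁻ h in closedBall 0 s, F (x + h) ∂μ := by
  rw [← lintegral_indicator measurableSet_closedBall,
    ← lintegral_indicator measurableSet_closedBall, ← lintegral_add_left_eq_self _ x]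
  refine lintegral_congr fun h => ?_
  simp [indicator]

variable [NormedSpace ℝ E] {p a s : ℝ} {f : E → ℝ} {x : E}

/-- The mean over the ball of radius `s` of the `p`-th power of the difference quotients of `f`
at scale `s`, up to the volume of the unit ball. -/
def scaledOsc (p : ℝ) (f : E → ℝ) (s : ℝ) (x : E) : ℝ≥0∞ :=
  ENNReal.ofReal (s ^ (-(p + finrank ℝ E))) * ∫⁻ h in closedBall 0 s, ‖f (x + h) - f x‖ₑ ^ p ∂μ

variable [FiniteDimensional ℝ E] [μ.IsAddHaarMeasure]

theorem exists_mollDefect_rpow_le (hp : 1 ≤ p) : ∃ C : ℝ≥0, ∀ f : E → ℝ,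
    LocallyIntegrable f μ → ∀ s : ℝ, 0 < s → ∀ x,
      mollDefect μ f s x ^ p ≤ C * scaledOsc μ p f s x := by
  obtain ⟨C, hC⟩ := exists_mollDefect_le μ
  have hp0 : 0 ≤ p := zero_le_one.trans hp
  have hp1 : 0 ≤ p - 1 := sub_nonneg.2 hp
  refine ⟨C ^ p * (μ (ball 0 1)).toNNReal ^ (p - 1), fun f hf s hs x => ?_⟩
  have hexp : ENNReal.ofReal (s ^ (finrank ℝ E + 1))⁻¹ ^ p *
      ENNReal.ofReal (s ^ finrank ℝ E) ^ (p - 1) =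
        ENNReal.ofReal (s ^ (-(p + finrank ℝ E))) := by
    rw [ENNReal.ofReal_rpow_of_nonneg (by positivity) hp0,
      ENNReal.ofReal_rpow_of_nonneg (by positivity) hp1, ← ENNReal.ofReal_mul (by positivity),
      ← Real.rpow_natCast, ← Real.rpow_natCast, ← Real.rpow_neg hs.le, ← Real.rpow_mul hs.le,
      ← Real.rpow_mul hs.le, ← Real.rpow_add hs]
    congr 2
    push_cast
    ring
  have hjensen := rpow_lintegral_enorm_le hp
    ((hf.integrableOn_isCompact (isCompact_closedBall x s)).aestronglyMeasurable.sub
      (aestronglyMeasurable_const (b := f x)))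
  rw [Measure.restrict_apply_univ, Measure.addHaar_closedBall _ _ hs.le,
    ENNReal.mul_rpow_of_nonneg _ _ hp1] at hjensen
  calc mollDefect μ f s x ^ p
      ≤ (C * ENNReal.ofReal (s ^ (finrank ℝ E + 1))⁻¹ *
          ∫⁻ y in closedBall x s, ‖f y - f x‖ₑ ∂μ) ^ p := by
        gcongr
        exact hC f hf s hs x
    _ ≤ C ^ p * ENNReal.ofReal (s ^ (finrank ℝ E + 1))⁻¹ ^ p *
          (ENNReal.ofReal (s ^ finrank ℝ E) ^ (p - 1) * μ (ball 0 1) ^ (p - 1) *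
            ∫⁻ y in closedBall x s, ‖f y - f x‖ₑ ^ p ∂μ) := by
        rw [ENNReal.mul_rpow_of_nonneg _ _ hp0, ENNReal.mul_rpow_of_nonneg _ _ hp0]
        gcongr
        exact hjensen
    _ = _ := by
        rw [scaledOsc, ← hexp, lintegral_closedBall_eq_comp_add μ (fun y => ‖f y - f x‖ₑ ^ p),
          ENNReal.coe_mul, ENNReal.coe_rpow_of_nonneg _ hp0, ENNReal.coe_rpow_of_nonneg _ hp1,
          ENNReal.coe_toNNReal measure_ball_lt_top.ne]
        ring

theorem measurable_scaledOsc (hf : Measurable f) :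
    Measurable fun q : ℝ × E => scaledOsc μ p f q.1 q.2 := by
  have hdiff : Measurable fun z : (ℝ × E) × E => ‖f (z.1.2 + z.2) - f z.1.2‖ₑ ^ p :=
    ((hf.comp (measurable_fst.snd.add measurable_snd)).sub
      (hf.comp measurable_fst.snd)).enorm.pow_const p
  have hball : MeasurableSet {z : (ℝ × E) × E | z.2 ∈ closedBall 0 z.1.1} := by
    simp only [mem_closedBall_zero_iff]
    exact measurableSet_le measurable_snd.norm measurable_fst.fst
  refine (measurable_fst.pow_const _).ennreal_ofReal.mul ?_
  simp only [← lintegral_indicator measurableSet_closedBall]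
  exact (hdiff.indicator hball).lintegral_prod_right'

theorem lintegral_scaledOsc_le (hp : 1 < p) (hf : Measurable f) :
    ∫⁻ s in Ioo 0 a, (∫⁻ x, scaledOsc μ p f s x ∂μ) ≤
      ENNReal.ofReal (p + finrank ℝ E - 1)⁻¹ *
        ∫⁻ x, ∫⁻ h in ball 0 a, ‖f (x + h) - f x‖ₑ ^ p / ‖h‖ₑ ^ (p + finrank ℝ E - 1) ∂μ ∂μ := by
  have hdim : 1 < p + finrank ℝ E := lt_add_of_lt_of_nonneg hp (Nat.cast_nonneg _)
  rw [lintegral_lintegral_swap (measurable_scaledOsc μ hf).aemeasurable,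
    ← lintegral_const_mul' _ _ ENNReal.ofReal_ne_top]
  refine lintegral_mono fun x => lintegral_Ioo_lintegral_closedBall_le μ hdim ?_
  exact ((hf.comp (measurable_const.add measurable_id)).sub_const (f x)).enorm.pow_const p

theorem measurable_mollDefect (hf : Measurable f) :
    Measurable fun q : ℝ × E => mollDefect μ f q.1 q.2 := by
  have hkernel : Measurable (mollKernel μ : ℝ × E → ℝ) :=
    (measurable_fst.pow_const _).inv.mul
      ((cutoffBump E one_pos).continuous_normed.measurable.comp
        (measurable_fst.inv.smul measurable_snd))
  have hmoll : Measurable (mollify μ f) := by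
    have hintegrand : Measurable fun z : (ℝ × E) × E => f z.2 * mollKernel μ (z.1.1, z.1.2 - z.2) :=
      (hf.comp measurable_snd).mul (hkernel.comp
        (measurable_fst.fst.prodMk (measurable_fst.snd.sub measurable_snd)))
    exact hintegrand.stronglyMeasurable.integral_prod_right'.measurable
  exact (measurable_fderiv ℝ _).enorm.add
    (measurable_fst.inv.mul (hmoll.sub (hf.comp measurable_snd))).enorm

end Oscillation

theorem screenedSeminorm_rpow {n : ℕ} {a p : ℝ} {f : Horiz n → ℝ} (hp : p ≠ 0) :
    screenedSeminorm a p f ^ p =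
      ∫⁻ x, ∫⁻ h in ball 0 a, ‖f (x + h) - f x‖ₑ ^ p / ‖h‖ₑ ^ (p + n - 1) := by
  rw [screenedSeminorm, ← ENNReal.rpow_mul, one_div_mul_cancel hp, ENNReal.rpow_one]

theorem exists_lintegral_mollDefect_rpow_le (n : ℕ) {p : ℝ} (hp : 1 < p) : ∃ C : ℝ≥0,
    ∀ f : Horiz n → ℝ, Measurable f → LocallyIntegrable f → ∀ a : ℝ,
      ∫⁻ s in Ioo 0 a, ∫⁻ x, mollDefect volume f s x ^ p ≤ C * screenedSeminorm a p f ^ p := by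
  obtain ⟨C, hC⟩ := exists_mollDefect_rpow_le (volume : Measure (Horiz n)) hp.le
  refine ⟨C * (p + n - 1)⁻¹.toNNReal, fun f hf hfi a => ?_⟩
  have hosc := lintegral_scaledOsc_le (volume : Measure (Horiz n)) (a := a) hp hf
  rw [finrank_euclideanSpace_fin, ← screenedSeminorm_rpow (one_pos.trans hp).ne'] at hosc
  calc ∫⁻ s in Ioo 0 a, ∫⁻ x, mollDefect volume f s x ^ p
      ≤ ∫⁻ s in Ioo 0 a, C * ∫⁻ x, scaledOsc volume p f s x := by
        refine setLIntegral_mono' measurableSet_Ioo fun s hs => ?_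
        rw [← lintegral_const_mul' _ _ ENNReal.coe_ne_top]
        exact lintegral_mono fun x => hC f hfi s hs.1 x
    _ ≤ C * (ENNReal.ofReal (p + n - 1)⁻¹ * screenedSeminorm a p f ^ p) := by
        rw [lintegral_const_mul' _ _ ENNReal.coe_ne_top]
        gcongr
    _ = _ := by rw [← mul_assoc, ENNReal.coe_mul, ENNReal.ofReal]

section StripGreen

variable {n : ℕ} {bm bp : ℝ} {u w : Full n → ℝ} {fm fp : Horiz n → ℝ}

theorem strip_eq_prod : strip n bm bp = univ ×ˢ Ioo bm bp := by
  ext x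
  simp [strip]

theorem isOpen_strip : IsOpen (strip n bm bp) := by
  rw [strip_eq_prod]
  exact isOpen_univ.prod isOpen_Ioo

theorem volume_restrict_strip : (volume : Measure (Full n)).restrict (strip n bm bp) =
    (volume : Measure (Horiz n)).prod (volume.restrict (Ioo bm bp)) := by
  rw [strip_eq_prod, Measure.volume_eq_prod, ← Measure.prod_restrict, Measure.restrict_univ]

theorem integral_fderiv_eq_zero_of_hasCompactSupport {E : Type*} [NormedAddCommGroup E]
    [NormedSpace ℝ E] [FiniteDimensional ℝ E] [MeasurableSpace E] [BorelSpace E] {μ : Measure E}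
    [μ.IsAddHaarMeasure] {g : E → ℝ} (hg : ContDiff ℝ 1 g) (hgc : HasCompactSupport g) (v : E) :
    ∫ x, fderiv ℝ g x v ∂μ = 0 := by
  have hderiv : Integrable (fun x => fderiv ℝ g x v) μ :=
    ((hg.continuous_fderiv one_ne_zero).clm_apply continuous_const).integrable_of_hasCompactSupport
      (hgc.fderiv_apply ℝ v)
  have hparts := integral_mul_fderiv_eq_neg_fderiv_mul_of_integrable (μ := μ) (f := fun _ => 1)
    (g := g) (v := v) (by simp) (by simpa using hderiv)
    (by simpa using hg.continuous.integrable_of_hasCompactSupport hgc)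
    (fun x _ => differentiableAt_const _) (fun x _ => hg.differentiable one_ne_zero x)
  simpa using hparts

theorem hasFDerivAt_horizontal_slice {x : Horiz n} {t : ℝ} (hw : DifferentiableAt ℝ w (x, t)) :
    HasFDerivAt (fun y => w (y, t))
      ((fderiv ℝ w (x, t)).comp (ContinuousLinearMap.inl ℝ (Horiz n) ℝ)) x :=
  hw.hasFDerivAt.comp x (hasFDerivAt_prodMk_left x t)

theorem hasDerivAt_vertical_slice {x : Horiz n} {t : ℝ} (hw : DifferentiableAt ℝ w (x, t)) :
    HasDerivAt (fun τ => w (x, τ)) (fderiv ℝ w (x, t) (0, 1)) t :=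
  hw.hasFDerivAt.comp_hasDerivAt t ((hasDerivAt_const t x).prodMk (hasDerivAt_id t))

theorem differentiableAt_of_mem_strip (hw : ContDiffOn ℝ 1 w (strip n bm bp))
    {x : Full n} (hx : x ∈ strip n bm bp) : DifferentiableAt ℝ w x :=
  (hw.contDiffAt (isOpen_strip.mem_nhds hx)).differentiableAt one_ne_zero

theorem integral_strip_fderiv_horizontal (hw : ContDiffOn ℝ 1 w (strip n bm bp))
    (hwc : HasCompactSupport w) (hi : IntegrableOn (fderiv ℝ w) (strip n bm bp)) (v : Horiz n) :
    ∫ x in strip n bm bp, fderiv ℝ w x (v, 0) = 0 := by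
  have hv := hi.apply_continuousLinearMap (v, 0)
  rw [volume_restrict_strip] at hv ⊢
  rw [integral_prod_symm _ hv]
  refine setIntegral_eq_zero_of_forall_eq_zero fun t ht => ?_
  have hslice : ContDiff ℝ 1 fun y : Horiz n => w (y, t) := contDiffOn_univ.1 <|
    hw.comp (contDiff_prodMk_left t).contDiffOn fun y _ => ht
  have hslicec : HasCompactSupport fun y : Horiz n => w (y, t) :=
    HasCompactSupport.intro (hwc.isCompact.image continuous_fst) fun y hy =>
      image_eq_zero_of_notMem_tsupport fun h => hy ⟨(y, t), h, rfl⟩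
  refine Eq.trans (integral_congr_ae (ae_of_all _ fun y => ?_))
    (integral_fderiv_eq_zero_of_hasCompactSupport hslice hslicec v)
  rw [(hasFDerivAt_horizontal_slice (differentiableAt_of_mem_strip hw ht)).fderiv]
  rfl

theorem integral_strip_fderiv_vertical (hb : bm < bp) (hw : ContDiffOn ℝ 1 w (strip n bm bp))
    (hi : IntegrableOn (fderiv ℝ w) (strip n bm bp)) (hfm : Integrable fm) (hfp : Integrable fp)
    (hlim_m : ∀ᵐ x, Tendsto (fun t => w (x, t)) (𝓝[>] bm) (𝓝 (fm x)))
    (hlim_p : ∀ᵐ x, Tendsto (fun t => w (x, t)) (𝓝[<] bp) (𝓝 (fp x))) :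
    ∫ x in strip n bm bp, fderiv ℝ w x (0, 1) = (∫ x, fp x) - ∫ x, fm x := by
  have hv := hi.apply_continuousLinearMap (0, 1)
  rw [volume_restrict_strip] at hv ⊢
  rw [integral_prod _ hv, ← integral_sub hfp hfm]
  refine integral_congr_ae ?_
  filter_upwards [hlim_m, hlim_p, hv.prod_right_ae] with x hxm hxp hxi
  rw [← intervalIntegral.integral_eq_sub_of_hasDerivAt_of_tendsto hb
    (fun t ht => hasDerivAt_vertical_slice (differentiableAt_of_mem_strip hw ht))
    ((intervalIntegrable_iff_integrableOn_Ioo_of_le hb.le).2 hxi) hxm hxp,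
    intervalIntegral.integral_of_le hb.le, integral_Ioc_eq_integral_Ioo]

theorem integral_strip_fderiv (hb : bm < bp) (hw : ContDiffOn ℝ 1 w (strip n bm bp))
    (hwc : HasCompactSupport w) (hi : IntegrableOn (fderiv ℝ w) (strip n bm bp))
    (hfm : Integrable fm) (hfp : Integrable fp)
    (hlim_m : ∀ᵐ x, Tendsto (fun t => w (x, t)) (𝓝[>] bm) (𝓝 (fm x)))
    (hlim_p : ∀ᵐ x, Tendsto (fun t => w (x, t)) (𝓝[<] bp) (𝓝 (fp x))) (v : Full n) :
    ∫ x in strip n bm bp, fderiv ℝ w x v = ((∫ x, fp x) - ∫ x, fm x) * v.2 := by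
  have hsplit (x : Full n) : fderiv ℝ w x v =
      fderiv ℝ w x (v.1, 0) + fderiv ℝ w x (0, 1) * v.2 := by
    rw [mul_comm, ← smul_eq_mul, ← map_smul, ← map_add]
    simp
  simp only [hsplit]
  rw [integral_add (hi.apply_continuousLinearMap _)
      ((hi.apply_continuousLinearMap _).mul_const _), integral_mul_const,
    integral_strip_fderiv_horizontal hw hwc hi, zero_add,
    integral_strip_fderiv_vertical hb hw hi hfm hfp hlim_m hlim_p]

theorem integrable_mul_slice {ψ : Full n → ℝ} (hψ : Continuous ψ) (hψc : HasCompactSupport ψ)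
    {f : Horiz n → ℝ} (hf : LocallyIntegrable f) (b : ℝ) : Integrable fun x => ψ (x, b) * f x := by
  refine hf.integrable_smul_left_of_hasCompactSupport (hψ.comp (by fun_prop)) ?_
  exact HasCompactSupport.intro (hψc.isCompact.image continuous_fst) fun x hx =>
    image_eq_zero_of_notMem_tsupport (f := ψ) fun h => hx ⟨(x, b), h, rfl⟩

theorem integral_strip_mul_fderiv (hb : bm < bp) (hu : ContDiffOn ℝ 1 u (strip n bm bp))
    (hui : LocallyIntegrable u (volume.restrict (strip n bm bp)))
    (hdi : LocallyIntegrable (fderiv ℝ u) (volume.restrict (strip n bm bp)))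
    (hfm : LocallyIntegrable fm) (hfp : LocallyIntegrable fp)
    (hlim_m : ∀ᵐ x, Tendsto (fun t => u (x, t)) (𝓝[>] bm) (𝓝 (fm x)))
    (hlim_p : ∀ᵐ x, Tendsto (fun t => u (x, t)) (𝓝[<] bp) (𝓝 (fp x)))
    {ψ : Full n → ℝ} (hψ : ContDiff ℝ 1 ψ) (hψc : HasCompactSupport ψ) (v : Full n) :
    ∫ x in strip n bm bp, u x * fderiv ℝ ψ x v =
      -(∫ x in strip n bm bp, ψ x * fderiv ℝ u x v)
        + ((∫ x', ψ (x', bp) * fp x' * v.2) + ∫ x', ψ (x', bm) * fm x' * (-v.2)) := by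
  have hleft : Integrable (fun x => u x • fderiv ℝ ψ x) (volume.restrict (strip n bm bp)) :=
    hui.integrable_smul_right_of_hasCompactSupport (hψ.continuous_fderiv one_ne_zero)
      (hψc.fderiv ℝ)
  have hright : Integrable (fun x => ψ x • fderiv ℝ u x) (volume.restrict (strip n bm bp)) :=
    hdi.integrable_smul_left_of_hasCompactSupport hψ.continuous hψc
  have hproduct : EqOn (fderiv ℝ fun x => ψ x * u x)
      (fun x => ψ x • fderiv ℝ u x + u x • fderiv ℝ ψ x) (strip n bm bp) := fun x hx =>
    fderiv_fun_mul (hψ.differentiable one_ne_zero x) (differentiableAt_of_mem_strip hu hx)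
  have hi : IntegrableOn (fderiv ℝ fun x => ψ x * u x) (strip n bm bp) :=
    (integrableOn_congr_fun hproduct isOpen_strip.measurableSet).2
      (Integrable.add (ε' := Full n →L[ℝ] ℝ) hright hleft)
  have hψ_tendsto (x : Horiz n) (s : Set ℝ) (b : ℝ) :
      Tendsto (fun t => ψ (x, t)) (𝓝[s] b) (𝓝 (ψ (x, b))) :=
    (hψ.continuous.comp (Continuous.prodMk_right x)).continuousWithinAt
  have hdiv := integral_strip_fderiv hb (hψ.contDiffOn.mul hu) hψc.mul_right hi
    (integrable_mul_slice hψ.continuous hψc hfm bm)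
    (integrable_mul_slice hψ.continuous hψc hfp bp)
    (hlim_m.mono fun x hx => (hψ_tendsto x _ bm).mul hx)
    (hlim_p.mono fun x hx => (hψ_tendsto x _ bp).mul hx) v
  rw [setIntegral_congr_fun (g := fun x => ψ x * fderiv ℝ u x v + u x * fderiv ℝ ψ x v)
    isOpen_strip.measurableSet (fun x hx => congrArg (· v) (hproduct hx)),
    integral_add (by simpa using hright.apply_continuousLinearMap v)
      (by simpa using hleft.apply_continuousLinearMap v)] at hdiv
  rw [integral_mul_const, integral_mul_const]
  linear_combination hdiv

end StripGreen

section WeakGradient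

variable {n : ℕ} {U : Set (Full n)} {u w : Full n → ℝ} {G H : Full n → Grad n}

theorem IsWeakGradient.congr (h : u =ᵐ[volume.restrict U] w) (hG : IsWeakGradient U u G) :
    IsWeakGradient U w G := by
  intro φ hφ hφc hφU v
  rw [← hG φ hφ hφc hφU v]
  refine integral_congr_ae ?_
  filter_upwards [h] with x hx
  rw [hx]

theorem IsWeakGradient.inner_integral_smul (hG : IsWeakGradient U u G)
    (hGi : LocallyIntegrable G (volume.restrict U)) {φ : Full n → ℝ} (hφ : ContDiff ℝ ∞ φ)
    (hφc : HasCompactSupport φ) (hφU : tsupport φ ⊆ U) (v : Grad n) :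
    inner ℝ v (∫ x in U, φ x • G x) = -∫ x in U, u x * fderiv ℝ φ x v.ofLp := by
  rw [← integral_inner (hGi.integrable_smul_left_of_hasCompactSupport hφ.continuous hφc),
    hG φ hφ hφc hφU, neg_neg]
  simp only [inner_smul_right, real_inner_comm v, WithLp.toLp_ofLp]

theorem IsWeakGradient.ae_eq (hU : IsOpen U) (hG : IsWeakGradient U u G)
    (hH : IsWeakGradient U u H) (hGi : LocallyIntegrable G (volume.restrict U))
    (hHi : LocallyIntegrable H (volume.restrict U)) : G =ᵐ[volume.restrict U] H := by
  have hzero : ∀ᵐ x, x ∈ U → G x - H x = 0 := by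
    refine hU.ae_eq_zero_of_integral_contDiff_smul_eq_zero
      (locallyIntegrableOn_of_locallyIntegrable_restrict (hGi.sub hHi)) fun φ hφ hφc hφU => ?_
    rw [← setIntegral_eq_integral_of_forall_compl_eq_zero (s := U) fun x hx => by
      rw [image_eq_zero_of_notMem_tsupport fun h => hx (hφU h), zero_smul]]
    simp only [smul_sub]
    rw [integral_sub (hGi.integrable_smul_left_of_hasCompactSupport hφ.continuous hφc)
      (hHi.integrable_smul_left_of_hasCompactSupport hφ.continuous hφc), sub_eq_zero]
    exact ext_inner_left ℝ fun v => by
      rw [hG.inner_integral_smul hGi hφ hφc hφU, hH.inner_integral_smul hHi hφ hφc hφU]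
  filter_upwards [(ae_restrict_iff' hU.measurableSet).2 hzero] with x hx
  exact sub_eq_zero.1 hx

/-- The gradient of `u` as a vector of `Grad n`, that is, with respect to the Euclidean inner
product; `Full n` carries the supremum norm, so Mathlib's `gradient` does not apply. -/
def euclideanGrad (u : Full n → ℝ) (x : Full n) : Grad n :=
  (InnerProductSpace.toDual ℝ (Grad n)).symm
    ((fderiv ℝ u x).comp (WithLp.prodContinuousLinearEquiv 2 ℝ (Horiz n) ℝ : Grad n →L[ℝ] Full n))

theorem inner_euclideanGrad (u : Full n → ℝ) (x v : Full n) :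
    inner ℝ (euclideanGrad u x) (WithLp.toLp 2 v) = fderiv ℝ u x v := by
  rw [euclideanGrad, InnerProductSpace.toDual_symm_apply]
  rfl

theorem norm_euclideanGrad_le (u : Full n → ℝ) (x : Full n) :
    ‖euclideanGrad u x‖ ≤ ‖fderiv ℝ u x‖ := by
  rw [euclideanGrad, LinearIsometryEquiv.norm_map]
  refine (ContinuousLinearMap.opNorm_comp_le _ _).trans
    (mul_le_of_le_one_right (norm_nonneg _) ?_)
  refine ContinuousLinearMap.opNorm_le_bound _ zero_le_one fun w => ?_
  rw [one_mul, WithLp.prod_norm_eq_of_L2]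
  exact max_le (Real.le_sqrt_of_sq_le (le_add_of_nonneg_right (sq_nonneg _)))
    (Real.le_sqrt_of_sq_le (le_add_of_nonneg_left (sq_nonneg _)))

theorem memLp_euclideanGrad {q : ℝ≥0∞} {μ : Measure (Full n)} (h : MemLp (fderiv ℝ u) q μ) :
    MemLp (euclideanGrad u) q μ := by
  refine h.mono ?_ (ae_of_all _ (norm_euclideanGrad_le u))
  have hc : Continuous fun D : Full n →L[ℝ] ℝ => (InnerProductSpace.toDual ℝ (Grad n)).symm
      (D.comp (WithLp.prodContinuousLinearEquiv 2 ℝ (Horiz n) ℝ : Grad n →L[ℝ] Full n)) := by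
    fun_prop
  exact hc.comp_aestronglyMeasurable h.1

end WeakGradient

section ClassicalExtension

variable {n : ℕ} {bm bp p : ℝ} {fm fp : Horiz n → ℝ} {u : Full n → ℝ}

/-- A `C¹` function on the strip, integrable up to the boundary on bounded sets and with `p`-th
power integrable gradient, whose limits along almost every vertical line are `f⁻` and `f⁺`. -/
structure IsClassicalExtension (bm bp p : ℝ) (fm fp : Horiz n → ℝ) (u : Full n → ℝ) : Prop where
  contDiffOn : ContDiffOn ℝ 1 u (strip n bm bp)
  locallyIntegrable : LocallyIntegrable u (volume.restrict (strip n bm bp))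
  memLp_fderiv : MemLp (fderiv ℝ u) (ENNReal.ofReal p) (volume.restrict (strip n bm bp))
  locallyIntegrable_minus : LocallyIntegrable fm
  locallyIntegrable_plus : LocallyIntegrable fp
  tendsto_minus : ∀ᵐ x, Tendsto (fun t => u (x, t)) (𝓝[>] bm) (𝓝 (fm x))
  tendsto_plus : ∀ᵐ x, Tendsto (fun t => u (x, t)) (𝓝[<] bp) (𝓝 (fp x))

namespace IsClassicalExtension

theorem integral_mul_fderiv (h : IsClassicalExtension bm bp p fm fp u) (hb : bm < bp) (hp : 1 ≤ p)
    {ψ : Full n → ℝ} (hψ : ContDiff ℝ 1 ψ) (hψc : HasCompactSupport ψ) (v : Full n) :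
    ∫ x in strip n bm bp, u x * fderiv ℝ ψ x v =
      -(∫ x in strip n bm bp, ψ x * inner ℝ (euclideanGrad u x) (WithLp.toLp 2 v))
        + ((∫ x', ψ (x', bp) * fp x' * v.2) + ∫ x', ψ (x', bm) * fm x' * (-v.2)) := by
  simp only [inner_euclideanGrad]
  exact integral_strip_mul_fderiv hb h.contDiffOn h.locallyIntegrable
    (h.memLp_fderiv.locallyIntegrable (by simpa using hp)) h.locallyIntegrable_minus
    h.locallyIntegrable_plus h.tendsto_minus h.tendsto_plus hψ hψc v

theorem isWeakGradient (h : IsClassicalExtension bm bp p fm fp u) (hb : bm < bp) (hp : 1 ≤ p) :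
    IsWeakGradient (strip n bm bp) u (euclideanGrad u) := by
  intro φ hφ hφc hφU v
  have hzero (b : ℝ) (hb : b ∉ Ioo bm bp) (x : Horiz n) : φ (x, b) = 0 :=
    image_eq_zero_of_notMem_tsupport fun hx => hb (hφU hx)
  rw [h.integral_mul_fderiv hb hp (hφ.of_le (by simp)) hφc v]
  simp [hzero bp (by simp), hzero bm (by simp)]

theorem memHomSobolev (h : IsClassicalExtension bm bp p fm fp u) (hb : bm < bp) (hp : 1 ≤ p) :
    MemHomSobolev (strip n bm bp) p u := by
  refine ⟨fun K hK hKU => ?_, _, h.isWeakGradient hb hp, memLp_euclideanGrad h.memLp_fderiv⟩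
  simpa only [IntegrableOn, Measure.restrict_restrict_of_subset hKU] using
    h.locallyIntegrable.integrableOn_isCompact hK

variable {hp : 1 < p} {w : HomSobolev (strip n bm bp) p hp}

theorem weakGrad_ae_eq (h : IsClassicalExtension bm bp p fm fp u) (hb : bm < bp)
    (hw : w.1 =ᵐ[volume.restrict (strip n bm bp)] u) :
    weakGrad w =ᵐ[volume.restrict (strip n bm bp)] euclideanGrad u := by
  have hp' : 1 ≤ ENNReal.ofReal p := by simpa using hp.le
  exact ((weakGrad_spec w).1.congr hw).ae_eq isOpen_strip (h.isWeakGradient hb hp.le)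
    ((weakGrad_spec w).2.locallyIntegrable hp')
    ((memLp_euclideanGrad h.memLp_fderiv).locallyIntegrable hp')

theorem hasTrace (h : IsClassicalExtension bm bp p fm fp u) (hb : bm < bp)
    (hw : w.1 =ᵐ[volume.restrict (strip n bm bp)] u)
    (hfm : ∀ K : Set (Horiz n), IsCompact K → MemLp fm (ENNReal.ofReal p) (volume.restrict K))
    (hfp : ∀ K : Set (Horiz n), IsCompact K → MemLp fp (ENNReal.ofReal p) (volume.restrict K)) :
    HasTrace w fm fp := by
  refine ⟨fun K hK => ⟨hfm K hK, hfp K hK⟩, fun K hK => ?_, fun ψ hψ hψc v => ?_⟩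
  · have hu : IntegrableOn u (K ∩ strip n bm bp) := by
      simpa only [IntegrableOn, Measure.restrict_restrict hK.measurableSet] using
        h.locallyIntegrable.integrableOn_isCompact hK
    exact hu.congr (ae_restrict_of_ae_restrict_of_subset inter_subset_right hw.symm)
  · rw [integral_congr_ae (hw.mono fun x hx => congrArg (· * fderiv ℝ ψ x v) hx),
      integral_congr_ae ((h.weakGrad_ae_eq hb hw).mono fun x hx =>
        congrArg (fun G => ψ x * inner ℝ G (WithLp.toLp 2 v)) hx)]
    exact h.integral_mul_fderiv hb hp.le hψ hψc v

end IsClassicalExtension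

end ClassicalExtension

theorem enorm_fderiv_interpolation_le {E : Type*} [NormedAddCommGroup E] [NormedSpace ℝ E]
    {t w₀ w₁ : E → ℝ} {x : E} (ht : DifferentiableAt ℝ t x) (hw₀ : DifferentiableAt ℝ w₀ x)
    (hw₁ : DifferentiableAt ℝ w₁ x) (hx : t x ∈ Icc 0 1) :
    ‖fderiv ℝ (fun y => (1 - t y) * w₀ y + t y * w₁ y) x‖ₑ ≤
      ‖fderiv ℝ w₀ x‖ₑ + ‖fderiv ℝ w₁ x‖ₑ + ‖w₁ x - w₀ x‖ₑ * ‖fderiv ℝ t x‖ₑ := by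
  have hderiv : fderiv ℝ (fun y => (1 - t y) * w₀ y + t y * w₁ y) x =
      (1 - t x) • fderiv ℝ w₀ x + t x • fderiv ℝ w₁ x + (w₁ x - w₀ x) • fderiv ℝ t x := by
    rw [(((ht.hasFDerivAt.const_sub 1).fun_mul hw₀.hasFDerivAt).fun_add
      (ht.hasFDerivAt.fun_mul hw₁.hasFDerivAt)).fderiv]
    module
  have hsmul {r : ℝ} (hr : r ∈ Icc 0 1) (D : E →L[ℝ] ℝ) : ‖r • D‖ₑ ≤ ‖D‖ₑ := by
    rw [enorm_smul, Real.enorm_of_nonneg hr.1]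
    exact mul_le_of_le_one_left zero_le (ENNReal.ofReal_le_one.2 hr.2)
  rw [hderiv, ← enorm_smul]
  refine (enorm_add_le (E := E →L[ℝ] ℝ) _ _).trans (add_le_add_left ?_ _)
  exact (enorm_add_le (E := E →L[ℝ] ℝ) _ _).trans <|
    add_le_add (hsmul ⟨sub_nonneg.2 hx.2, sub_le_self _ hx.1⟩ _) (hsmul hx _)

section FaceMollification

variable {n : ℕ} {f g : Horiz n → ℝ} {b c : ℝ} {x : Full n}

/-- The mollification of a function on the face `{x_N = b}` at the scale `c (x_N - b)`; the sign of
`c` tells on which side of the face it is used, so that the scale is positive there. -/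
def faceMollify (f : Horiz n → ℝ) (b c : ℝ) (x : Full n) : ℝ :=
  mollify volume f (c * (x.2 - b), x.1)

theorem contDiffAt_faceMollify (hf : LocallyIntegrable f) (hx : 0 < c * (x.2 - b)) :
    ContDiffAt ℝ ∞ (faceMollify f b c) x := by
  have hnhds : Ioi (0 : ℝ) ×ˢ univ ∈ 𝓝 (c * (x.2 - b), x.1) :=
    (isOpen_Ioi.prod isOpen_univ).mem_nhds ⟨hx, mem_univ _⟩
  exact ((contDiffOn_mollify volume hf).contDiffAt hnhds).comp x (by fun_prop)

theorem enorm_fderiv_faceMollify_le (hf : LocallyIntegrable f) (hc : |c| ≤ 1)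
    (hx : 0 < c * (x.2 - b)) : ‖fderiv ℝ (faceMollify f b c) x‖ₑ ≤
      ‖fderiv ℝ (mollify volume f) (c * (x.2 - b), x.1)‖ₑ := by
  have hnhds : Ioi (0 : ℝ) ×ˢ univ ∈ 𝓝 (c * (x.2 - b), x.1) :=
    (isOpen_Ioi.prod isOpen_univ).mem_nhds ⟨hx, mem_univ _⟩
  have hmoll := (((contDiffOn_mollify volume hf).contDiffAt hnhds).differentiableAt
    (by simp)).hasFDerivAt
  have hscale : HasFDerivAt (fun y : Full n => (c * (y.2 - b), y.1))
      ((c • ContinuousLinearMap.snd ℝ (Horiz n) ℝ).prod (ContinuousLinearMap.fst ℝ _ _)) x :=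
    ((hasFDerivAt_snd.sub_const b).const_mul c).prodMk hasFDerivAt_fst
  have hscale_norm :
      ‖(c • ContinuousLinearMap.snd ℝ (Horiz n) ℝ).prod (ContinuousLinearMap.fst ℝ _ _)‖ ≤ 1 := by
    refine ContinuousLinearMap.opNorm_le_bound _ zero_le_one fun y => ?_
    rw [one_mul]
    refine max_le ?_ (norm_fst_le y)
    exact (norm_smul c y.2).trans_le
      ((mul_le_of_le_one_left (norm_nonneg _) hc).trans (norm_snd_le y))
  have hderiv : fderiv ℝ (faceMollify f b c) x = _ := (hmoll.comp x hscale).fderiv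
  rw [hderiv, enorm_le_iff_norm_le]
  exact (ContinuousLinearMap.opNorm_comp_le _ _).trans
    (mul_le_of_le_one_right (norm_nonneg _) hscale_norm)

theorem enorm_fderiv_faceMollify_add_le (hf : LocallyIntegrable f) (hc : |c| ≤ 1)
    (hx : 0 < c * (x.2 - b)) {d : ℝ} (hd : c * (x.2 - b) ≤ d) :
    ‖fderiv ℝ (faceMollify f b c) x‖ₑ + ‖d⁻¹ * (faceMollify f b c x - f x.1)‖ₑ ≤
      mollDefect volume f (c * (x.2 - b)) x.1 := by
  refine add_le_add (enorm_fderiv_faceMollify_le hf hc hx) ?_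
  rw [enorm_mul, enorm_mul, Real.enorm_of_nonneg (inv_pos.2 (hx.trans_le hd)).le,
    Real.enorm_of_nonneg (inv_pos.2 hx).le]
  gcongr
  rfl

theorem enorm_sub_mollify_le {E : Type*} [NormedAddCommGroup E] [NormedSpace ℝ E]
    [FiniteDimensional ℝ E] [MeasurableSpace E] (μ : Measure E) {f : E → ℝ} {s : ℝ} (hs : 0 < s)
    (x : E) : ‖f x - mollify μ f (s, x)‖ₑ ≤ ENNReal.ofReal s * mollDefect μ f s x := by
  calc ‖f x - mollify μ f (s, x)‖ₑ = ‖s * (s⁻¹ * (mollify μ f (s, x) - f x))‖ₑ := by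
        rw [mul_inv_cancel_left₀ hs.ne', enorm_sub_rev]
    _ ≤ ENNReal.ofReal s * mollDefect μ f s x := by
        rw [enorm_mul, Real.enorm_of_nonneg hs.le]
        exact mul_le_mul_right le_add_self _

theorem ae_tendsto_faceMollify (hf : LocallyIntegrable f) {S : Set ℝ}
    (hS : ∀ t ∈ S, 0 < c * (t - b)) :
    ∀ᵐ x, Tendsto (fun t => faceMollify f b c (x, t)) (𝓝[S] b) (𝓝 (f x)) := by
  have hscale : Tendsto (fun t => c * (t - b)) (𝓝[S] b) (𝓝[>] 0) := by
    refine tendsto_nhdsWithin_iff.2 ⟨?_, eventually_mem_nhdsWithin.mono hS⟩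
    have hcont : Continuous fun t => c * (t - b) := by fun_prop
    simpa using (hcont.tendsto b).mono_left nhdsWithin_le_nhds
  filter_upwards [ae_tendsto_mollify volume hf] with x hx
  exact hx.comp hscale

end FaceMollification

section StripExtension

variable {n : ℕ} {bm bp κ : ℝ} {fm fp gm gp : Horiz n → ℝ} {x : Full n}

/-- The affine function of `x_N` that is `0` on `Γ⁻` and `1` on `Γ⁺`. -/
def stripHeight (bm bp : ℝ) (x : Full n) : ℝ := (bp - bm)⁻¹ * (x.2 - bm)

/-- The extension of the boundary data: the linear interpolation, in `x_N`, between the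
mollifications of `f⁻` and `f⁺` at the scales `κ dist(x, Γ^±)`. -/
def stripExtension (bm bp κ : ℝ) (fm fp : Horiz n → ℝ) (x : Full n) : ℝ :=
  (1 - stripHeight bm bp x) * faceMollify fm bm κ x + stripHeight bm bp x * faceMollify fp bp (-κ) x

/-- The pointwise bound for the gradient of the extension. -/
def gradBound (bm bp κ : ℝ) (fm fp : Horiz n → ℝ) (x : Full n) : ℝ≥0∞ :=
  mollDefect volume fm (κ * (x.2 - bm)) x.1 + mollDefect volume fp (-κ * (x.2 - bp)) x.1 +
    ‖(bp - bm)⁻¹ * (fp x.1 - fm x.1)‖ₑ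

theorem stripHeight_mem_Icc (hx : x ∈ strip n bm bp) : stripHeight bm bp x ∈ Icc (0 : ℝ) 1 := by
  have hb : 0 < bp - bm := sub_pos.2 (hx.1.trans hx.2)
  rw [stripHeight, inv_mul_eq_div]
  exact ⟨div_nonneg (sub_pos.2 hx.1).le hb.le,
    div_le_one_of_le₀ (sub_le_sub_right hx.2.le bm) hb.le⟩

theorem scale_minus_mem_Ioo (hκ : 0 < κ) {t : ℝ} (ht : t ∈ Ioo bm bp) :
    κ * (t - bm) ∈ Ioo 0 (κ * (bp - bm)) :=
  ⟨mul_pos hκ (sub_pos.2 ht.1), mul_lt_mul_of_pos_left (sub_lt_sub_right ht.2 bm) hκ⟩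

theorem scale_plus_mem_Ioo (hκ : 0 < κ) {t : ℝ} (ht : t ∈ Ioo bm bp) :
    -κ * (t - bp) ∈ Ioo 0 (κ * (bp - bm)) := by
  rw [neg_mul_comm, neg_sub]
  exact ⟨mul_pos hκ (sub_pos.2 ht.2), mul_lt_mul_of_pos_left (sub_lt_sub_left ht.1 bp) hκ⟩

theorem stripExtension_congr_ae (hm : fm =ᵐ[volume] gm) (hp : fp =ᵐ[volume] gp) :
    stripExtension bm bp κ fm fp = stripExtension bm bp κ gm gp := by
  ext x
  simp only [stripExtension, faceMollify, mollify_congr_ae volume hm, mollify_congr_ae volume hp]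

theorem stripExtension_add (hκ : 0 < κ) (hfm : LocallyIntegrable fm) (hfp : LocallyIntegrable fp)
    (hgm : LocallyIntegrable gm) (hgp : LocallyIntegrable gp) (hx : x ∈ strip n bm bp) :
    stripExtension bm bp κ (fm + gm) (fp + gp) x =
      stripExtension bm bp κ fm fp x + stripExtension bm bp κ gm gp x := by
  simp only [stripExtension, faceMollify]
  rw [mollify_add volume hfm hgm (scale_minus_mem_Ioo hκ hx).1,
    mollify_add volume hfp hgp (scale_plus_mem_Ioo hκ hx).1]
  ring

theorem stripExtension_smul (r : ℝ) :
    stripExtension bm bp κ (r • fm) (r • fp) = r • stripExtension bm bp κ fm fp := by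
  ext x
  simp only [stripExtension, faceMollify, mollify_smul, Pi.smul_apply, smul_eq_mul]
  ring

theorem contDiff_stripHeight : ContDiff ℝ ∞ (stripHeight bm bp : Full n → ℝ) := by
  unfold stripHeight
  fun_prop

theorem enorm_fderiv_stripHeight_le :
    ‖fderiv ℝ (stripHeight bm bp) x‖ₑ ≤ ‖(bp - bm)⁻¹‖ₑ := by
  have hderiv : HasFDerivAt (stripHeight bm bp)
      ((bp - bm)⁻¹ • ContinuousLinearMap.snd ℝ (Horiz n) ℝ) x :=
    (hasFDerivAt_snd.sub_const bm).const_mul _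
  rw [hderiv.fderiv, enorm_le_iff_norm_le, norm_smul]
  exact mul_le_of_le_one_right (norm_nonneg _) (ContinuousLinearMap.norm_snd_le _ _ _)

theorem contDiffOn_stripExtension (hκ : 0 < κ) (hfm : LocallyIntegrable fm)
    (hfp : LocallyIntegrable fp) :
    ContDiffOn ℝ ∞ (stripExtension bm bp κ fm fp) (strip n bm bp) := fun x hx => by
  have hheight := (contDiff_stripHeight (n := n) (bm := bm) (bp := bp)).contDiffAt (x := x)
  exact ((contDiffAt_const.sub hheight).mul (contDiffAt_faceMollify hfm
    (scale_minus_mem_Ioo hκ hx).1) |>.add (hheight.mul (contDiffAt_faceMollify hfp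
    (scale_plus_mem_Ioo hκ hx).1))).contDiffWithinAt

theorem enorm_fderiv_stripExtension_le (hκ : 0 < κ) (hκ1 : κ ≤ 1) (hfm : LocallyIntegrable fm)
    (hfp : LocallyIntegrable fp) (hx : x ∈ strip n bm bp) :
    ‖fderiv ℝ (stripExtension bm bp κ fm fp) x‖ₑ ≤ gradBound bm bp κ fm fp x := by
  have hscale : κ * (bp - bm) ≤ bp - bm :=
    mul_le_of_le_one_left (sub_pos.2 (hx.1.trans hx.2)).le hκ1
  obtain ⟨hm, hm'⟩ := scale_minus_mem_Ioo hκ hx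
  obtain ⟨hp, hp'⟩ := scale_plus_mem_Ioo hκ hx
  set Wm := faceMollify fm bm κ
  set Wp := faceMollify fp bp (-κ)
  set r := (bp - bm)⁻¹
  have hjump : ‖Wp x - Wm x‖ₑ * ‖r‖ₑ ≤
      ‖r * (Wp x - fp x.1)‖ₑ + ‖r * (fp x.1 - fm x.1)‖ₑ + ‖r * (Wm x - fm x.1)‖ₑ := by
    rw [← enorm_mul, show (Wp x - Wm x) * r =
      r * (Wp x - fp x.1) + r * (fp x.1 - fm x.1) - r * (Wm x - fm x.1) by ring]
    exact enorm_sub_le.trans (add_le_add_left (enorm_add_le _ _) _)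
  calc ‖fderiv ℝ (stripExtension bm bp κ fm fp) x‖ₑ
      ≤ ‖fderiv ℝ Wm x‖ₑ + ‖fderiv ℝ Wp x‖ₑ + ‖Wp x - Wm x‖ₑ * ‖fderiv ℝ (stripHeight bm bp) x‖ₑ :=
        enorm_fderiv_interpolation_le (contDiff_stripHeight.contDiffAt.differentiableAt (by simp))
          ((contDiffAt_faceMollify hfm hm).differentiableAt (by simp))
          ((contDiffAt_faceMollify hfp hp).differentiableAt (by simp)) (stripHeight_mem_Icc hx)
    _ ≤ ‖fderiv ℝ Wm x‖ₑ + ‖fderiv ℝ Wp x‖ₑ +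
        (‖r * (Wp x - fp x.1)‖ₑ + ‖r * (fp x.1 - fm x.1)‖ₑ + ‖r * (Wm x - fm x.1)‖ₑ) := by
        gcongr
        exact (mul_le_mul_right enorm_fderiv_stripHeight_le _).trans hjump
    _ = (‖fderiv ℝ Wm x‖ₑ + ‖r * (Wm x - fm x.1)‖ₑ) +
        (‖fderiv ℝ Wp x‖ₑ + ‖r * (Wp x - fp x.1)‖ₑ) + ‖r * (fp x.1 - fm x.1)‖ₑ := by ring
    _ ≤ gradBound bm bp κ fm fp x := by
        refine add_le_add_left (add_le_add ?_ ?_) _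
        · exact enorm_fderiv_faceMollify_add_le hfm (by rwa [abs_of_pos hκ]) hm
            (hm'.le.trans hscale)
        · exact enorm_fderiv_faceMollify_add_le hfp (by rwa [abs_neg, abs_of_pos hκ]) hp
            (hp'.le.trans hscale)

theorem enorm_stripExtension_le (hκ : 0 < κ) (hκ1 : κ ≤ 1) (hx : x ∈ strip n bm bp) :
    ‖stripExtension bm bp κ fm fp x‖ₑ ≤
      ‖fm x.1‖ₑ + ‖fp x.1‖ₑ + ENNReal.ofReal (bp - bm) * gradBound bm bp κ fm fp x := by
  have hscale : κ * (bp - bm) ≤ bp - bm :=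
    mul_le_of_le_one_left (sub_pos.2 (hx.1.trans hx.2)).le hκ1
  have hface {f : Horiz n → ℝ} {s : ℝ} (hs : s ∈ Ioo 0 (κ * (bp - bm))) :
      ‖mollify volume f (s, x.1)‖ₑ ≤
        ‖f x.1‖ₑ + ENNReal.ofReal (bp - bm) * mollDefect volume f s x.1 := by
    calc ‖mollify volume f (s, x.1)‖ₑ = ‖f x.1 - (f x.1 - mollify volume f (s, x.1))‖ₑ := by
          rw [sub_sub_cancel]
      _ ≤ _ := enorm_sub_le.trans (add_le_add_right ((enorm_sub_mollify_le volume hs.1 x.1).trans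
          (mul_le_mul_left (ENNReal.ofReal_le_ofReal (hs.2.le.trans hscale)) _)) _)
  have hmul {r : ℝ} (hr : r ∈ Icc 0 1) (w : ℝ) : ‖r * w‖ₑ ≤ ‖w‖ₑ := by
    rw [enorm_mul, Real.enorm_of_nonneg hr.1]
    exact mul_le_of_le_one_left zero_le (ENNReal.ofReal_le_one.2 hr.2)
  have ht := stripHeight_mem_Icc hx
  calc ‖stripExtension bm bp κ fm fp x‖ₑ
      ≤ ‖faceMollify fm bm κ x‖ₑ + ‖faceMollify fp bp (-κ) x‖ₑ :=
        (enorm_add_le _ _).trans (add_le_add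
          (hmul ⟨sub_nonneg.2 ht.2, sub_le_self _ ht.1⟩ _) (hmul ht _))
    _ ≤ (‖fm x.1‖ₑ + ENNReal.ofReal (bp - bm) * mollDefect volume fm (κ * (x.2 - bm)) x.1) +
        (‖fp x.1‖ₑ + ENNReal.ofReal (bp - bm) * mollDefect volume fp (-κ * (x.2 - bp)) x.1) :=
        add_le_add (hface (scale_minus_mem_Ioo hκ hx)) (hface (scale_plus_mem_Ioo hκ hx))
    _ ≤ _ := by
        rw [add_add_add_comm, ← mul_add]
        exact add_le_add_right (mul_le_mul_right le_self_add _) _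

theorem tendsto_stripHeight (x : Horiz n) (S : Set ℝ) (b : ℝ) :
    Tendsto (fun t => stripHeight bm bp (x, t)) (𝓝[S] b) (𝓝 (stripHeight bm bp (x, b))) :=
  (contDiff_stripHeight.continuous.comp (Continuous.prodMk_right x)).continuousWithinAt

theorem ae_tendsto_stripExtension_minus (hb : bm < bp) (hκ : 0 < κ) (hfm : LocallyIntegrable fm)
    (hfp : LocallyIntegrable fp) :
    ∀ᵐ x, Tendsto (fun t => stripExtension bm bp κ fm fp (x, t)) (𝓝[>] bm) (𝓝 (fm x)) := by
  filter_upwards [ae_tendsto_faceMollify hfm fun t ht => mul_pos hκ (sub_pos.2 ht)] with x hx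
  have hscale : 0 < -κ * (bm - bp) := mul_pos_of_neg_of_neg (neg_lt_zero.2 hκ) (sub_neg.2 hb)
  have hfar : Tendsto (fun t => faceMollify fp bp (-κ) (x, t)) (𝓝[>] bm)
      (𝓝 (faceMollify fp bp (-κ) (x, bm))) :=
    ((contDiffAt_faceMollify hfp hscale).continuousAt.comp
      (Continuous.prodMk_right x).continuousAt).continuousWithinAt
  have hheight := tendsto_stripHeight (bm := bm) (bp := bp) x (Ioi bm) bm
  simpa [stripExtension, stripHeight] using ((hheight.const_sub 1).mul hx).add (hheight.mul hfar)

theorem ae_tendsto_stripExtension_plus (hb : bm < bp) (hκ : 0 < κ) (hfm : LocallyIntegrable fm)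
    (hfp : LocallyIntegrable fp) :
    ∀ᵐ x, Tendsto (fun t => stripExtension bm bp κ fm fp (x, t)) (𝓝[<] bp) (𝓝 (fp x)) := by
  filter_upwards [ae_tendsto_faceMollify hfp (c := -κ) fun t (ht : t < bp) =>
    mul_pos_of_neg_of_neg (neg_lt_zero.2 hκ) (sub_neg.2 ht)] with x hx
  have hfar : Tendsto (fun t => faceMollify fm bm κ (x, t)) (𝓝[<] bp)
      (𝓝 (faceMollify fm bm κ (x, bp))) :=
    ((contDiffAt_faceMollify hfm (mul_pos hκ (sub_pos.2 hb))).continuousAt.comp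
      (Continuous.prodMk_right x).continuousAt).continuousWithinAt
  have hheight := tendsto_stripHeight (bm := bm) (bp := bp) x (Iio bp) bp
  simpa [stripExtension, stripHeight, (sub_pos.2 hb).ne'] using
    ((hheight.const_sub 1).mul hfar).add (hheight.mul hx)

end StripExtension

section Energy

variable {n : ℕ} {bm bp κ a p : ℝ} {f fm fp : Horiz n → ℝ}

theorem lintegral_strip_scale_le {b c r : ℝ} (hc : c ≠ 0)
    (hcr : ∀ t ∈ Ioo bm bp, c * (t - b) ∈ Ioo 0 r) {F : ℝ × Horiz n → ℝ≥0∞} (hF : Measurable F) :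
    ∫⁻ x in strip n bm bp, F (c * (x.2 - b), x.1) ≤
      ENNReal.ofReal |c|⁻¹ * ∫⁻ s in Ioo 0 r, ∫⁻ x, F (s, x) := by
  have hmeas : Measurable fun x : Full n => F (c * (x.2 - b), x.1) :=
    hF.comp (((measurable_snd.sub_const b).const_mul c).prodMk measurable_fst)
  have hchange := lintegral_image_eq_lintegral_abs_deriv_mul (s := Ioo bm bp)
    (f := fun t => c * (t - b)) (f' := fun _ => c) measurableSet_Ioo
    (fun t _ => by simpa using (((hasDerivAt_id t).sub_const b).const_mul c).hasDerivWithinAt)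
    (fun t _ t' _ h => by simpa [hc] using h) (fun s => ∫⁻ x, F (s, x))
  rw [lintegral_const_mul' _ _ ENNReal.ofReal_ne_top] at hchange
  calc ∫⁻ x in strip n bm bp, F (c * (x.2 - b), x.1)
      = ∫⁻ t in Ioo bm bp, ∫⁻ x, F (c * (t - b), x) := by
        rw [volume_restrict_strip, lintegral_prod_symm _ hmeas.aemeasurable]
    _ = ENNReal.ofReal |c|⁻¹ *
          ∫⁻ s in (fun t => c * (t - b)) '' Ioo bm bp, ∫⁻ x, F (s, x) := by
        rw [hchange, ← mul_assoc, ← ENNReal.ofReal_mul (by positivity),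
          inv_mul_cancel₀ (abs_ne_zero.2 hc), ENNReal.ofReal_one, one_mul]
    _ ≤ ENNReal.ofReal |c|⁻¹ * ∫⁻ s in Ioo 0 r, ∫⁻ x, F (s, x) := by
        gcongr
        exact image_subset_iff.2 hcr

theorem lintegral_strip_jump (hb : bm < bp) (hp : 0 ≤ p) (hfm : Measurable fm)
    (hfp : Measurable fp) :
    ∫⁻ x in strip n bm bp, ‖(bp - bm)⁻¹ * (fp x.1 - fm x.1)‖ₑ ^ p =
      ENNReal.ofReal ((bp - bm) ^ (1 - p)) * ∫⁻ x, ‖fp x - fm x‖ₑ ^ p := by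
  have hb' : 0 < bp - bm := sub_pos.2 hb
  have hmeas : Measurable fun x : Horiz n => ‖fp x - fm x‖ₑ ^ p :=
    (hfp.sub hfm).enorm.pow_const p
  have hconst : ‖(bp - bm)⁻¹‖ₑ ^ p * ENNReal.ofReal (bp - bm) =
      ENNReal.ofReal ((bp - bm) ^ (1 - p)) := by
    rw [Real.enorm_of_nonneg (by positivity), ENNReal.ofReal_rpow_of_pos (by positivity),
      ← ENNReal.ofReal_mul (by positivity), Real.inv_rpow hb'.le, ← Real.rpow_neg hb'.le,
      ← Real.rpow_add_one hb'.ne', neg_add_eq_sub]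
  simp only [enorm_mul, ENNReal.mul_rpow_of_nonneg _ _ hp]
  rw [lintegral_const_mul' _ _ (ENNReal.rpow_ne_top_of_nonneg hp (by simp)), volume_restrict_strip,
    lintegral_prod (fun x : Horiz n × ℝ => ‖fp x.1 - fm x.1‖ₑ ^ p)
      (hmeas.comp measurable_fst).aemeasurable]
  simp only [lintegral_const, Measure.restrict_apply_univ, Real.volume_Ioo]
  rw [lintegral_mul_const _ hmeas, ← hconst]
  ring

theorem gradBound_rpow_le (hp : 1 ≤ p) (x : Full n) :
    gradBound bm bp κ fm fp x ^ p ≤ 3 ^ (p - 1) *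
      (mollDefect volume fm (κ * (x.2 - bm)) x.1 ^ p +
        mollDefect volume fp (-κ * (x.2 - bp)) x.1 ^ p +
        ‖(bp - bm)⁻¹ * (fp x.1 - fm x.1)‖ₑ ^ p) := by
  simpa [gradBound, Fin.sum_univ_three] using ENNReal.rpow_sum_le_const_mul_sum_rpow Finset.univ
    ![mollDefect volume fm (κ * (x.2 - bm)) x.1, mollDefect volume fp (-κ * (x.2 - bp)) x.1,
      ‖(bp - bm)⁻¹ * (fp x.1 - fm x.1)‖ₑ] hp

theorem measurable_mollDefect_scale (hf : Measurable f) (b c : ℝ) :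
    Measurable fun x : Full n => mollDefect volume f (c * (x.2 - b)) x.1 :=
  (measurable_mollDefect volume hf).comp (g := fun q : ℝ × Horiz n => mollDefect volume f q.1 q.2)
    (f := fun x : Full n => (c * (x.2 - b), x.1))
    (((measurable_snd.sub_const b).const_mul c).prodMk measurable_fst)

theorem exists_lintegral_strip_mollDefect_rpow_le (n : ℕ) (hp : 1 < p) :
    ∃ C : ℝ≥0, ∀ f : Horiz n → ℝ, Measurable f → LocallyIntegrable f →
      ∀ bm bp a b c : ℝ, c ≠ 0 → (∀ t ∈ Ioo bm bp, c * (t - b) ∈ Ioo 0 a) →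
        ∫⁻ x in strip n bm bp, mollDefect volume f (c * (x.2 - b)) x.1 ^ p ≤
          ENNReal.ofReal |c|⁻¹ * C * screenedSeminorm a p f ^ p := by
  obtain ⟨C, hC⟩ := exists_lintegral_mollDefect_rpow_le n hp
  refine ⟨C, fun f hf hfi bm bp a b c hc hscale => ?_⟩
  refine (lintegral_strip_scale_le hc hscale
    ((measurable_mollDefect volume hf).pow_const p)).trans ?_
  rw [mul_assoc]
  exact mul_le_mul_right (hC f hf hfi a) _

theorem exists_lintegral_gradBound_rpow_le (n : ℕ) (hp : 1 < p) (hκ : 0 < κ) :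
    ∃ C : ℝ≥0, ∀ bm bp a : ℝ, bm < bp → κ * (bp - bm) ≤ a → ∀ fm fp : Horiz n → ℝ,
      Measurable fm → Measurable fp → LocallyIntegrable fm → LocallyIntegrable fp →
      ∫⁻ x in strip n bm bp, gradBound bm bp κ fm fp x ^ p ≤
        C * (ENNReal.ofReal ((bp - bm) ^ (1 - p)) * (∫⁻ x, ‖fp x - fm x‖ₑ ^ p)
          + screenedSeminorm a p fm ^ p + screenedSeminorm a p fp ^ p) := by
  obtain ⟨C, hC⟩ := exists_lintegral_strip_mollDefect_rpow_le n hp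
  refine ⟨3 ^ (p - 1) * (κ⁻¹.toNNReal * C + 1),
    fun bm bp a hb ha fm fp hfm hfp hfmi hfpi => ?_⟩
  have hminus := hC fm hfm hfmi bm bp a bm κ hκ.ne'
    fun t ht => Ioo_subset_Ioo_right ha (scale_minus_mem_Ioo hκ ht)
  have hplus := hC fp hfp hfpi bm bp a bp (-κ) (neg_ne_zero.2 hκ.ne')
    fun t ht => Ioo_subset_Ioo_right ha (scale_plus_mem_Ioo hκ ht)
  rw [abs_neg] at hplus
  rw [abs_of_pos hκ] at hminus hplus
  have hmeas_minus := (measurable_mollDefect_scale hfm bm κ).pow_const p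
  have hmeas_sum : Measurable fun x : Full n => mollDefect volume fm (κ * (x.2 - bm)) x.1 ^ p +
      mollDefect volume fp (-κ * (x.2 - bp)) x.1 ^ p :=
    hmeas_minus.add ((measurable_mollDefect_scale hfp bp (-κ)).pow_const p)
  set D : ℝ≥0∞ := ENNReal.ofReal κ⁻¹ * C
  set Sm := screenedSeminorm a p fm ^ p
  set Sp := screenedSeminorm a p fp ^ p
  set J := ENNReal.ofReal ((bp - bm) ^ (1 - p)) * ∫⁻ x, ‖fp x - fm x‖ₑ ^ p
  calc ∫⁻ x in strip n bm bp, gradBound bm bp κ fm fp x ^ p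
      ≤ ∫⁻ x in strip n bm bp, 3 ^ (p - 1) * (mollDefect volume fm (κ * (x.2 - bm)) x.1 ^ p +
          mollDefect volume fp (-κ * (x.2 - bp)) x.1 ^ p +
          ‖(bp - bm)⁻¹ * (fp x.1 - fm x.1)‖ₑ ^ p) :=
        lintegral_mono fun x => gradBound_rpow_le hp.le x
    _ ≤ 3 ^ (p - 1) * (D * Sm + D * Sp + J) := by
        rw [lintegral_const_mul' _ _ (ENNReal.rpow_ne_top_of_nonneg (sub_nonneg.2 hp.le) (by simp)),
          lintegral_add_left hmeas_sum, lintegral_add_left hmeas_minus,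
          lintegral_strip_jump hb (zero_le_one.trans hp.le) hfm hfp]
        exact mul_le_mul_right (add_le_add_left (add_le_add hminus hplus) J) _
    _ ≤ 3 ^ (p - 1) * ((D * Sm + D * Sp + J) + (D * J + Sm + Sp)) :=
        mul_le_mul_right le_self_add _
    _ = 3 ^ (p - 1) * (D + 1) * (J + Sm + Sp) := by ring
    _ = _ := by
        push_cast [ENNReal.coe_rpow_of_nonneg _ (sub_nonneg.2 hp.le)]
        rfl

theorem lintegral_gradBound_rpow_lt_top (hp : 1 < p) (hκ : 0 < κ) (hb : bm < bp)
    (ha : κ * (bp - bm) ≤ a) (hfm : Measurable fm) (hfp : Measurable fp)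
    (h : MemTraceData a p fm fp) :
    ∫⁻ x in strip n bm bp, gradBound bm bp κ fm fp x ^ p < ⊤ := by
  have hp0 : 0 < p := one_pos.trans hp
  obtain ⟨C, hC⟩ := exists_lintegral_gradBound_rpow_le n hp hκ
  have hjump := lintegral_rpow_enorm_lt_top_of_eLpNorm_lt_top (by simpa using hp0)
    ENNReal.ofReal_ne_top h.diff.2
  rw [ENNReal.toReal_ofReal hp0.le] at hjump
  have hminus := h.screened_minus.ne
  have hplus := h.screened_plus.ne
  refine (hC bm bp a hb ha fm fp hfm hfp h.locInt_minus h.locInt_plus).trans_lt ?_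
  finiteness

theorem exists_memLp_sub_mollify (hp : 1 < p) (ha : 0 < a) (hf : Measurable f)
    (hfi : LocallyIntegrable f) (hs : screenedSeminorm a p f < ⊤) :
    ∃ s, 0 < s ∧ MemLp (fun x => f x - mollify volume f (s, x)) (ENNReal.ofReal p) := by
  have hp0 : 0 < p := one_pos.trans hp
  obtain ⟨C, hC⟩ := exists_lintegral_mollDefect_rpow_le n hp
  have hfinite : ∫⁻ s in Ioo 0 a, ∫⁻ x, mollDefect volume f s x ^ p < ⊤ :=
    (hC f hf hfi a).trans_lt (ENNReal.mul_lt_top ENNReal.coe_lt_top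
      (ENNReal.rpow_lt_top_of_nonneg hp0.le hs.ne))
  have hslices := ae_lt_top
    ((measurable_mollDefect volume hf).pow_const p).lintegral_prod_right' hfinite.ne
  have : (ae (volume.restrict (Ioo 0 a))).NeBot := by
    rw [ae_neBot, Ne, Measure.restrict_eq_zero, Real.volume_Ioo]
    simpa using ha
  obtain ⟨s, hsfin, hs0, -⟩ := (hslices.and (ae_restrict_mem measurableSet_Ioo)).exists
  refine ⟨s, hs0, (hf.sub (continuous_mollify volume hfi hs0).measurable).aestronglyMeasurable, ?_⟩
  rw [eLpNorm_lt_top_iff_lintegral_rpow_enorm_lt_top (by simpa using hp0) ENNReal.ofReal_ne_top,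
    ENNReal.toReal_ofReal hp0.le]
  calc ∫⁻ x, ‖f x - mollify volume f (s, x)‖ₑ ^ p
      ≤ ∫⁻ x, ENNReal.ofReal s ^ p * mollDefect volume f s x ^ p := by
        refine lintegral_mono fun x => ?_
        rw [← ENNReal.mul_rpow_of_nonneg _ _ hp0.le]
        exact ENNReal.rpow_le_rpow (enorm_sub_mollify_le volume hs0 x) hp0.le
    _ < ⊤ := by
        have hconst := ENNReal.rpow_ne_top_of_nonneg hp0.le (ENNReal.ofReal_ne_top (r := s))
        rw [lintegral_const_mul' _ _ hconst]
        exact ENNReal.mul_lt_top hconst.lt_top hsfin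

theorem memLp_restrict_of_screenedSeminorm_lt_top (hp : 1 < p) (ha : 0 < a) (hf : Measurable f)
    (hfi : LocallyIntegrable f) (hs : screenedSeminorm a p f < ⊤) {K : Set (Horiz n)}
    (hK : IsCompact K) : MemLp f (ENNReal.ofReal p) (volume.restrict K) := by
  obtain ⟨s, hs0, hdiff⟩ := exists_memLp_sub_mollify hp ha hf hfi hs
  have hmoll : MemLp (fun x => mollify volume f (s, x)) (ENNReal.ofReal p) (volume.restrict K) := by
    have hcont := continuous_mollify volume hfi hs0
    obtain ⟨B, hB⟩ := hK.exists_bound_of_continuousOn hcont.continuousOn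
    have : IsFiniteMeasure (volume.restrict K) := ⟨by simpa using hK.measure_lt_top⟩
    exact MemLp.of_bound hcont.aestronglyMeasurable B ((ae_restrict_mem hK.measurableSet).mono hB)
  exact ((hdiff.restrict K).add hmoll).ae_eq (ae_of_all _ fun x => sub_add_cancel _ _)

theorem lintegral_lt_top_of_lintegral_rpow_lt_top {α : Type*} [MeasurableSpace α] {μ : Measure α}
    [IsFiniteMeasure μ] {g : α → ℝ≥0∞} (hp : 1 ≤ p) (h : ∫⁻ x, g x ^ p ∂μ < ⊤) :
    ∫⁻ x, g x ∂μ < ⊤ := by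
  have hle (x : α) : g x ≤ 1 + g x ^ p := by
    rcases le_total (g x) 1 with h1 | h1
    · exact h1.trans le_self_add
    · exact (ENNReal.le_rpow_self_of_one_le h1 hp).trans le_add_self
  refine (lintegral_mono hle).trans_lt ?_
  rw [lintegral_add_left measurable_const]
  exact ENNReal.add_lt_top.2 ⟨by simp, h⟩

theorem locallyIntegrable_comp_fst_strip (hf : LocallyIntegrable f) :
    LocallyIntegrable (fun x : Full n => f x.1) (volume.restrict (strip n bm bp)) := by
  refine locallyIntegrable_iff.2 fun K hK => ?_
  have hprod : IntegrableOn (fun x : Full n => f x.1) ((Prod.fst '' K) ×ˢ univ)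
      (volume.restrict (strip n bm bp)) := by
    rw [IntegrableOn, volume_restrict_strip, ← Measure.prod_restrict, Measure.restrict_univ]
    exact (hf.integrableOn_isCompact (hK.image continuous_fst)).comp_fst _
  exact hprod.mono_set fun x hx => ⟨⟨x, hx, rfl⟩, mem_univ _⟩

theorem locallyIntegrable_stripExtension (hp : 1 ≤ p) (hκ : 0 < κ) (hκ1 : κ ≤ 1)
    (hfm : LocallyIntegrable fm) (hfp : LocallyIntegrable fp)
    (hE : ∫⁻ x in strip n bm bp, gradBound bm bp κ fm fp x ^ p < ⊤) :
    LocallyIntegrable (stripExtension bm bp κ fm fp) (volume.restrict (strip n bm bp)) := by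
  refine locallyIntegrable_iff.2 fun K hK => ⟨?_, ?_⟩
  · exact ((contDiffOn_stripExtension hκ hfm hfp).continuousOn.aestronglyMeasurable
      isOpen_strip.measurableSet).restrict
  have hIm := (locallyIntegrable_comp_fst_strip (bm := bm) (bp := bp) hfm).integrableOn_isCompact hK
  have hIp := (locallyIntegrable_comp_fst_strip (bm := bm) (bp := bp) hfp).integrableOn_isCompact hK
  have : IsFiniteMeasure ((volume.restrict (strip n bm bp)).restrict K) :=
    ⟨by simpa using hK.measure_lt_top⟩
  have hle : ∀ᵐ x ∂(volume.restrict (strip n bm bp)).restrict K,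
      ‖stripExtension bm bp κ fm fp x‖ₑ ≤
        ‖fm x.1‖ₑ + (‖fp x.1‖ₑ + ENNReal.ofReal (bp - bm) * gradBound bm bp κ fm fp x) :=
    ae_restrict_of_ae <| (ae_restrict_mem isOpen_strip.measurableSet).mono fun x hx =>
      (enorm_stripExtension_le hκ hκ1 hx).trans_eq (add_assoc _ _ _)
  refine (lintegral_mono_ae hle).trans_lt ?_
  rw [lintegral_add_left' hIm.1.enorm, lintegral_add_left' hIp.1.enorm,
    lintegral_const_mul' _ _ ENNReal.ofReal_ne_top]
  exact ENNReal.add_lt_top.2 ⟨hIm.2, ENNReal.add_lt_top.2 ⟨hIp.2, ENNReal.mul_lt_top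
    ENNReal.ofReal_lt_top (lintegral_lt_top_of_lintegral_rpow_lt_top hp
      ((lintegral_mono' Measure.restrict_le_self le_rfl).trans_lt hE))⟩⟩

theorem memLp_fderiv_stripExtension (hp : 0 < p) (hκ : 0 < κ) (hκ1 : κ ≤ 1)
    (hfm : LocallyIntegrable fm) (hfp : LocallyIntegrable fp)
    (hE : ∫⁻ x in strip n bm bp, gradBound bm bp κ fm fp x ^ p < ⊤) :
    MemLp (fderiv ℝ (stripExtension bm bp κ fm fp)) (ENNReal.ofReal p)
      (volume.restrict (strip n bm bp)) := by
  refine ⟨((contDiffOn_stripExtension hκ hfm hfp).continuousOn_fderiv_of_isOpen isOpen_strip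
    (by simp)).aestronglyMeasurable isOpen_strip.measurableSet, ?_⟩
  rw [eLpNorm_lt_top_iff_lintegral_rpow_enorm_lt_top (by simpa using hp) ENNReal.ofReal_ne_top,
    ENNReal.toReal_ofReal hp.le]
  refine (setLIntegral_mono' isOpen_strip.measurableSet fun x hx => ?_).trans_lt hE
  exact ENNReal.rpow_le_rpow (enorm_fderiv_stripExtension_le hκ hκ1 hfm hfp hx) hp.le

theorem isClassicalExtension_stripExtension (hb : bm < bp) (hp : 1 ≤ p) (hκ : 0 < κ) (hκ1 : κ ≤ 1)
    (hfm : LocallyIntegrable fm) (hfp : LocallyIntegrable fp)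
    (hE : ∫⁻ x in strip n bm bp, gradBound bm bp κ fm fp x ^ p < ⊤) :
    IsClassicalExtension bm bp p fm fp (stripExtension bm bp κ fm fp) where
  contDiffOn := (contDiffOn_stripExtension hκ hfm hfp).of_le (by simp)
  locallyIntegrable := locallyIntegrable_stripExtension hp hκ hκ1 hfm hfp hE
  memLp_fderiv := memLp_fderiv_stripExtension (one_pos.trans_le hp) hκ hκ1 hfm hfp hE
  locallyIntegrable_minus := hfm
  locallyIntegrable_plus := hfp
  tendsto_minus := ae_tendsto_stripExtension_minus hb hκ hfm hfp
  tendsto_plus := ae_tendsto_stripExtension_plus hb hκ hfm hfp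

end Energy

section ExtensionOperator

variable {n : ℕ} {bm bp κ a p : ℝ}

theorem isClassicalExtension_of_traceData (hp : 1 < p) (hκ : 0 < κ) (hκ1 : κ ≤ 1) (hb : bm < bp)
    (ha : κ * (bp - bm) ≤ a) (f : TraceData n a p hp) :
    IsClassicalExtension bm bp p f.1.1 f.1.2 (stripExtension bm bp κ f.1.1 f.1.2) :=
  isClassicalExtension_stripExtension hb hp.le hκ hκ1 f.2.locInt_minus f.2.locInt_plus
    (lintegral_gradBound_rpow_lt_top hp hκ hb ha f.1.1.measurable f.1.2.measurable f.2)

/-- The extension `(f⁻, f⁺) ↦ stripExtension f⁻ f⁺` as a linear map on classes of functions; the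
condition `κ (b⁺ - b⁻) ≤ a` keeps all the mollification scales below the screening length. -/
def stripExtensionMap (hp : 1 < p) (hκ : 0 < κ) (hκ1 : κ ≤ 1) (hb : bm < bp)
    (ha : κ * (bp - bm) ≤ a) : TraceData n a p hp →ₗ[ℝ] HomSobolev (strip n bm bp) p hp where
  toFun f := ⟨AEEqFun.mk (stripExtension bm bp κ f.1.1 f.1.2)
      (isClassicalExtension_of_traceData hp hκ hκ1 hb ha f).locallyIntegrable.aestronglyMeasurable,
    ((isClassicalExtension_of_traceData hp hκ hκ1 hb ha f).memHomSobolev hb hp.le).congr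
      (AEEqFun.coeFn_mk _ _).symm⟩
  map_add' f g := by
    refine Subtype.ext ?_
    simp only [Submodule.coe_add]
    rw [AEEqFun.mk_add_mk, AEEqFun.mk_eq_mk]
    filter_upwards [ae_restrict_mem isOpen_strip.measurableSet] with x hx
    exact (congrFun (stripExtension_congr_ae (AEEqFun.coeFn_add f.1.1 g.1.1)
      (AEEqFun.coeFn_add f.1.2 g.1.2)) x).trans
      (stripExtension_add hκ f.2.locInt_minus f.2.locInt_plus g.2.locInt_minus
        g.2.locInt_plus hx)
  map_smul' r f := by
    refine Subtype.ext ?_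
    simp only [Submodule.coe_smul, RingHom.id_apply]
    rw [AEEqFun.smul_mk, AEEqFun.mk_eq_mk]
    exact .of_eq ((stripExtension_congr_ae (AEEqFun.coeFn_smul r f.1.1)
      (AEEqFun.coeFn_smul r f.1.2)).trans (stripExtension_smul r))

variable (hp : 1 < p) (hκ : 0 < κ) (hκ1 : κ ≤ 1) (hb : bm < bp) (ha : κ * (bp - bm) ≤ a)

theorem coeFn_stripExtensionMap (f : TraceData n a p hp) :
    (stripExtensionMap hp hκ hκ1 hb ha f).1 =ᵐ[volume.restrict (strip n bm bp)]
      stripExtension bm bp κ f.1.1 f.1.2 :=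
  AEEqFun.coeFn_mk _ _

theorem hasTrace_stripExtensionMap (f : TraceData n a p hp) :
    HasTrace (stripExtensionMap hp hκ hκ1 hb ha f) f.1.1 f.1.2 :=
  have ha0 : 0 < a := (mul_pos hκ (sub_pos.2 hb)).trans_le ha
  (isClassicalExtension_of_traceData hp hκ hκ1 hb ha f).hasTrace hb
    (coeFn_stripExtensionMap hp hκ hκ1 hb ha f)
    (fun _ => memLp_restrict_of_screenedSeminorm_lt_top hp ha0 f.1.1.measurable f.2.locInt_minus
      f.2.screened_minus)
    fun _ => memLp_restrict_of_screenedSeminorm_lt_top hp ha0 f.1.2.measurable f.2.locInt_plus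
      f.2.screened_plus

theorem lintegral_weakGrad_stripExtensionMap_rpow_le (f : TraceData n a p hp) :
    ∫⁻ x in strip n bm bp, ‖weakGrad (stripExtensionMap hp hκ hκ1 hb ha f) x‖ₑ ^ p ≤
      ∫⁻ x in strip n bm bp, gradBound bm bp κ f.1.1 f.1.2 x ^ p := by
  refine lintegral_mono_ae ?_
  filter_upwards [(isClassicalExtension_of_traceData hp hκ hκ1 hb ha f).weakGrad_ae_eq hb
      (coeFn_stripExtensionMap hp hκ hκ1 hb ha f),
    ae_restrict_mem isOpen_strip.measurableSet] with x hgrad hx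
  rw [hgrad]
  refine ENNReal.rpow_le_rpow ?_ (zero_le_one.trans hp.le)
  exact (enorm_le_iff_norm_le.2 (norm_euclideanGrad_le _ x)).trans
    (enorm_fderiv_stripExtension_le hκ hκ1 f.2.locInt_minus f.2.locInt_plus hx)

end ExtensionOperator

end


/-- Here `N = n + 1 ≥ 2`. The constant `c` depends only on `N`, `p` and a positive lower bound `l`
for the ratio `a / (b⁺ - b⁻)`. -/
theorem theorem1p3 (n : ℕ) (hn : 1 ≤ n) (p : ℝ) (hp : 1 < p) (l : ℝ) (hl : 0 < l) :
    ∃ c : ℝ, 0 < c ∧ ∀ bm bp a : ℝ, bm < bp → 0 < a → l ≤ a / (bp - bm) →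
      ∃ L : TraceData n a p hp →ₗ[ℝ] HomSobolev (strip n bm bp) p hp,
        ∀ f : TraceData n a p hp,
          HasTrace (L f) f.1.1 f.1.2 ∧
          (∫⁻ x in strip n bm bp, ‖weakGrad (L f) x‖ₑ ^ p) ≤
            ENNReal.ofReal c *
              (ENNReal.ofReal ((bp - bm) ^ (1 - p)) * (∫⁻ x', ‖f.1.2 x' - f.1.1 x'‖ₑ ^ p)
                + screenedSeminorm a p f.1.1 ^ p + screenedSeminorm a p f.1.2 ^ p) := by
  have hκ : 0 < min l 1 := lt_min hl one_pos
  have hκ1 : min l 1 ≤ 1 := min_le_right _ _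
  obtain ⟨C, hC⟩ := exists_lintegral_gradBound_rpow_le n hp hκ
  refine ⟨C + 1, by positivity, fun bm bp a hb _ hl_le => ?_⟩
  have ha : min l 1 * (bp - bm) ≤ a :=
    (le_div_iff₀ (sub_pos.2 hb)).1 ((min_le_left _ _).trans hl_le)
  refine ⟨stripExtensionMap hp hκ hκ1 hb ha, fun f =>
    ⟨hasTrace_stripExtensionMap hp hκ hκ1 hb ha f, ?_⟩⟩
  have hC_le : (C : ℝ≥0∞) ≤ ENNReal.ofReal (C + 1) := by
    rw [← ENNReal.ofReal_coe_nnreal]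
    exact ENNReal.ofReal_le_ofReal (le_add_of_nonneg_right zero_le_one)
  exact ((lintegral_weakGrad_stripExtensionMap_rpow_le hp hκ hκ1 hb ha f).trans
    (hC bm bp a hb ha f.1.1 f.1.2 f.1.1.measurable f.1.2.measurable f.2.locInt_minus
      f.2.locInt_plus)).trans (mul_le_mul_left hC_le _)
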